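/- Let $k$ be a commutative ring and let $H$ be a Hopf algebra over $k$ with bijective antipode $S$, projective as a $k$-module. For a right $H$-comodule write $\rho(m)=m_{[0]}\otimes m_{[1]}$. A right $H$-comodule algebra is a $k$-algebra $A$ with a right $H$-coaction that is an algebra map $A\to A\otimes H$ (unadorned tensor products are over $k$); its coinvariants are $A^{\mathrm{co}H}=\{a\in A\mid \rho(a)=a\otimes 1\}$. We call $A$ a right faithfully flat $H$-Galois extension of $A^{\mathrm{co}H}$ if the canonical map $$A\otimes_{A^{\mathrm{co}H}}A\to A\otimes H,\qquad a\otimes b\mapsto a_{[0]}b\otimes a_{[1]},$$ is bijective and $A$ is faithfully flat as a right $A^{\mathrm{co}H}$-module. Let ${}_A\mathcal M^H$ be the category of relative Hopf modules: the objects are left $A$-modules $M$ with a right $H$-coaction such that $\rho(am)=a_{[0]}m_{[0]}\otimes a_{[1]}m_{[1]}$, and the morphisms are the $A$-linear and $H$-colinear maps. For $M\in{}_A\mathcal M^H$, let ${}_A\mathrm{END}(M)$ be the algebra of those $f\in{}_A\mathrm{End}(M)$ for which there is a (necessarily unique) $f_{[0]}\otimes f_{[1]}\in{}_A\mathrm{End}(M)\otimes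 H$ with $$f_{[0]}(m)\otimes f_{[1]}=f(m_{[0]})_{[0]}\otimes S^{-1}(m_{[1]})\,f(m_{[0]})_{[1]}\qquad\text{for all } m\in M.$$ With the coaction $f\mapsto f_{[0]}\otimes f_{[1]}$, the opposite algebra ${}_A\mathrm{END}(M)^{\mathrm{op}}$ is a right $H$-comodule algebra. A left $A$-module $M$ is a progenerator if and only if $A$ and $M$ are mutually direct summands of finite direct sums of copies of each other; an object $M\in{}_A\mathcal M^H$ is called an $H$-progenerator if this property holds in the category ${}_A\mathcal M^H$. **Theorem.** Let $A$ be a right $H$-comodule algebra that is a right faithfully flat $H$-Galois extension of $A^{\mathrm{co}H}$, and let $M\in{}_A\mathcal M^H$ be a progenerator as a left $A$-module. Then $B={}_A\mathrm{END}(M)^{\mathrm{op}}$ is a right faithfully flat $H$-Galois extension of $B^{\mathrm{co}H}$ if and only if $M$ is an $H$-progenerator. -/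

import Mathlib

open scoped TensorProduct

universe u v

namespace HopfGalois



/-! ### Hopf algebras with bijective antipode, and right comodules -/

section Comodules

variable (k : Type*) (H : Type*) [CommRing k] [Ring H] [HopfAlgebra k H]

/-- The antipode `S` of the Hopf algebra `H` is bijective. -/
class BijectiveAntipode : Prop where
  bijective : Function.Bijective (HopfAlgebra.antipode k : H →ₗ[k] H)

/-- The inverse `S⁻¹` of the antipode. -/
noncomputable def antipodeInv [BijectiveAntipode k H] : H →ₗ[k] H :=
  (LinearEquiv.ofBijective (HopfAlgebra.antipode k : H →ₗ[k] H)
    BijectiveAntipode.bijective).symm.toLinearMap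

/-- A right `H`-comodule structure `m ↦ m₀ ⊗ m₁` on the `k`-module `M`. -/
class RightComodule (M : Type*) [AddCommGroup M] [Module k M] where
  /-- The right coaction. -/
  coact : M →ₗ[k] M ⊗[k] H
  coassoc : (TensorProduct.assoc k M H H).toLinearMap ∘ₗ coact.rTensor H ∘ₗ coact =
    (Coalgebra.comul : H →ₗ[k] H ⊗[k] H).lTensor M ∘ₗ coact
  counit : (TensorProduct.rid k M).toLinearMap ∘ₗ
    (Coalgebra.counit : H →ₗ[k] k).lTensor M ∘ₗ coact = LinearMap.id

/-- The right coaction `m ↦ m₀ ⊗ m₁`. -/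
abbrev coact (M : Type*) [AddCommGroup M] [Module k M] [RightComodule k H M] :
    M →ₗ[k] M ⊗[k] H :=
  RightComodule.coact

/-- `A` is a right `H`-comodule algebra: the coaction `A → A ⊗ H` is a morphism of algebras. -/
class IsComoduleAlgebra (A : Type*) [Ring A] [Algebra k A] [RightComodule k H A] : Prop where
  coact_one : coact k H A 1 = 1
  coact_mul : ∀ a b : A, coact k H A (a * b) = coact k H A a * coact k H A b

/-- The action of `A ⊗ H` on `M ⊗ H` given by `(a ⊗ h) (m ⊗ g) = a m ⊗ h g`. -/
noncomputable def diagAct (A M : Type*) [Ring A] [Algebra k A] [AddCommGroup M] [Module k M]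
    [Module A M] [IsScalarTower k A M] :
    A ⊗[k] H →ₗ[k] M ⊗[k] H →ₗ[k] M ⊗[k] H :=
  TensorProduct.map₂ (Algebra.lsmul k k M : A →ₐ[k] Module.End k M).toLinearMap
    (LinearMap.mul k H)

/-- `M` is an object of the category of (left-right) relative Hopf modules over the right
`H`-comodule algebra `A`: a left `A`-module and right `H`-comodule such that
`ρ(a m) = a₀ m₀ ⊗ a₁ m₁`. -/
class IsHopfModule (A M : Type*) [Ring A] [Algebra k A] [RightComodule k H A]
    [AddCommGroup M] [Module k M] [Module A M] [IsScalarTower k A M]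
    [RightComodule k H M] : Prop where
  coact_smul : ∀ (a : A) (m : M),
    coact k H M (a • m) = diagAct k H A M (coact k H A a) (coact k H M m)

/-- A comodule algebra is a relative Hopf module over itself. -/
instance isHopfModuleSelf (A : Type*) [Ring A] [Algebra k A] [RightComodule k H A]
    [IsComoduleAlgebra k H A] : IsHopfModule k H A A where
  coact_smul a m := by
    have key : ∀ x y : A ⊗[k] H, diagAct k H A A x y = x * y := by
      intro x y
      induction x using TensorProduct.induction_on with
      | zero => simp
      | add x₁ x₂ h₁ h₂ => rw [map_add, LinearMap.add_apply, h₁, h₂, add_mul]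
      | tmul a h =>
        induction y using TensorProduct.induction_on with
        | zero => simp
        | add x₁ x₂ h₁ h₂ => rw [map_add, h₁, h₂, mul_add]
        | tmul b g => simp [diagAct]
    rw [key, smul_eq_mul, IsComoduleAlgebra.coact_mul]

/-- The coaction on `Mⁿ`: the sum over `j` of the coactions of the `j`-th components. -/
noncomputable def piCoact (M : Type*) [AddCommGroup M] [Module k M] [RightComodule k H M]
    (n : ℕ) : (Fin n → M) →ₗ[k] (Fin n → M) ⊗[k] H :=
  ∑ j : Fin n, (LinearMap.single k (fun _ : Fin n => M) j).rTensor H ∘ₗ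
    coact k H M ∘ₗ LinearMap.proj j

theorem piCoact_comp_single (M : Type*) [AddCommGroup M] [Module k M] [RightComodule k H M]
    (n : ℕ) (j : Fin n) : piCoact k H M n ∘ₗ LinearMap.single k (fun _ : Fin n => M) j =
      (LinearMap.single k (fun _ : Fin n => M) j).rTensor H ∘ₗ coact k H M := by
  ext m
  simp only [piCoact, LinearMap.comp_apply, LinearMap.sum_apply, LinearMap.proj_apply,
    LinearMap.single_apply]
  rw [Finset.sum_eq_single j]
  · simp
  · intro i _ hij
    rw [Pi.single_eq_of_ne hij, map_zero, map_zero]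
  · simp

/-- The finite direct sum `Mⁿ` of a right comodule, with the componentwise coaction. -/
noncomputable instance rightComodulePi (M : Type*) [AddCommGroup M] [Module k M]
    [RightComodule k H M] (n : ℕ) : RightComodule k H (Fin n → M) where
  coact := piCoact k H M n
  coassoc := by
    refine LinearMap.pi_ext' fun j => ?_
    set s := LinearMap.single k (fun _ : Fin n => M) j
    have h1 : (TensorProduct.assoc k (Fin n → M) H H).toLinearMap ∘ₗ (s.rTensor H).rTensor H =
        s.rTensor (H ⊗[k] H) ∘ₗ (TensorProduct.assoc k M H H).toLinearMap := by
      ext; simp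
    have h2 : (Coalgebra.comul : H →ₗ[k] H ⊗[k] H).lTensor (Fin n → M) ∘ₗ s.rTensor H =
        s.rTensor (H ⊗[k] H) ∘ₗ (Coalgebra.comul : H →ₗ[k] H ⊗[k] H).lTensor M := by
      ext; simp
    have h3 : (piCoact k H M n).rTensor H ∘ₗ s.rTensor H =
        (s.rTensor H).rTensor H ∘ₗ (coact k H M).rTensor H := by
      rw [← LinearMap.rTensor_comp, piCoact_comp_single, LinearMap.rTensor_comp]
    have h0 := RightComodule.coassoc (k := k) (H := H) (M := M)
    calc _ = (TensorProduct.assoc k (Fin n → M) H H).toLinearMap ∘ₗ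
        (piCoact k H M n).rTensor H ∘ₗ (piCoact k H M n ∘ₗ s) := rfl
      _ = (TensorProduct.assoc k (Fin n → M) H H).toLinearMap ∘ₗ
        ((piCoact k H M n).rTensor H ∘ₗ s.rTensor H) ∘ₗ coact k H M := by
          rw [piCoact_comp_single]; rfl
      _ = ((TensorProduct.assoc k (Fin n → M) H H).toLinearMap ∘ₗ (s.rTensor H).rTensor H) ∘ₗ
        (coact k H M).rTensor H ∘ₗ coact k H M := by rw [h3]; rfl
      _ = s.rTensor (H ⊗[k] H) ∘ₗ ((TensorProduct.assoc k M H H).toLinearMap ∘ₗ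
        (coact k H M).rTensor H ∘ₗ coact k H M) := by rw [h1]; rfl
      _ = ((Coalgebra.comul : H →ₗ[k] H ⊗[k] H).lTensor (Fin n → M) ∘ₗ s.rTensor H) ∘ₗ
        coact k H M := by rw [h0, h2]; rfl
      _ = (Coalgebra.comul : H →ₗ[k] H ⊗[k] H).lTensor (Fin n → M) ∘ₗ
        (piCoact k H M n ∘ₗ s) := by rw [piCoact_comp_single]; rfl
      _ = _ := rfl
  counit := by
    refine LinearMap.pi_ext' fun j => ?_
    set s := LinearMap.single k (fun _ : Fin n => M) j
    have h1 : (TensorProduct.rid k (Fin n → M)).toLinearMap ∘ₗ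
        (Coalgebra.counit : H →ₗ[k] k).lTensor (Fin n → M) ∘ₗ s.rTensor H =
        s ∘ₗ (TensorProduct.rid k M).toLinearMap ∘ₗ
        (Coalgebra.counit : H →ₗ[k] k).lTensor M := by
      ext; simp
    have h0 := RightComodule.counit (k := k) (H := H) (M := M)
    calc _ = ((TensorProduct.rid k (Fin n → M)).toLinearMap ∘ₗ
        (Coalgebra.counit : H →ₗ[k] k).lTensor (Fin n → M)) ∘ₗ
        (piCoact k H M n ∘ₗ s) := rfl
      _ = ((TensorProduct.rid k (Fin n → M)).toLinearMap ∘ₗ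
        (Coalgebra.counit : H →ₗ[k] k).lTensor (Fin n → M) ∘ₗ s.rTensor H) ∘ₗ coact k H M := by
          rw [piCoact_comp_single]; rfl
      _ = s ∘ₗ ((TensorProduct.rid k M).toLinearMap ∘ₗ
        (Coalgebra.counit : H →ₗ[k] k).lTensor M ∘ₗ coact k H M) := by rw [h1]; rfl
      _ = _ := by rw [h0]; rfl

instance isHopfModulePi (A M : Type*) [Ring A] [Algebra k A] [RightComodule k H A]
    [AddCommGroup M] [Module k M] [Module A M] [IsScalarTower k A M]
    [RightComodule k H M] [IsHopfModule k H A M] (n : ℕ) :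
    IsHopfModule k H A (Fin n → M) where
  coact_smul a m := by
    have key : ∀ (j : Fin n) (x : A ⊗[k] H) (y : M ⊗[k] H),
        (LinearMap.single k (fun _ : Fin n => M) j).rTensor H (diagAct k H A M x y) =
        diagAct k H A (Fin n → M) x ((LinearMap.single k (fun _ : Fin n => M) j).rTensor H y) := by
      intro j x y
      induction x using TensorProduct.induction_on with
      | zero => simp
      | add x₁ x₂ h₁ h₂ => simp only [map_add, LinearMap.add_apply, h₁, h₂]
      | tmul a h =>
        induction y using TensorProduct.induction_on with
        | zero => simp
        | add x₁ x₂ h₁ h₂ => simp only [map_add, h₁, h₂]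
        | tmul b g => simp [diagAct, Pi.single_smul']
    change piCoact k H M n (a • m) = diagAct k H A (Fin n → M) (coact k H A a) (piCoact k H M n m)
    simp only [piCoact, LinearMap.sum_apply, LinearMap.comp_apply, LinearMap.proj_apply,
      Pi.smul_apply, map_sum, IsHopfModule.coact_smul, key]

/-- The subalgebra of coinvariants `{a | ρ(a) = a ⊗ 1}` of a right comodule algebra. -/
noncomputable def coinvariants (A : Type*) [Ring A] [Algebra k A] [RightComodule k H A]
    [IsComoduleAlgebra k H A] : Subalgebra k A where
  carrier := {a | coact k H A a = a ⊗ₜ[k] (1 : H)}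
  mul_mem' := by
    intro a b ha hb
    simp only [Set.mem_ofPred_eq] at ha hb ⊢
    rw [IsComoduleAlgebra.coact_mul, ha, hb, Algebra.TensorProduct.tmul_mul_tmul, one_mul]
  add_mem' := by
    intro a b ha hb
    simp only [Set.mem_ofPred_eq] at ha hb ⊢
    rw [map_add, ha, hb, TensorProduct.add_tmul]
  algebraMap_mem' := by
    intro r
    simp only [Set.mem_ofPred_eq]
    rw [Algebra.algebraMap_eq_smul_one, map_smul, IsComoduleAlgebra.coact_one,
      Algebra.TensorProduct.one_def, TensorProduct.smul_tmul']

end Comodules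

/-! ### Tensor products over a noncommutative algebra, and faithful flatness -/

section Balanced

variable (k : Type*) [CommRing k]

/-- The `k`-submodule of `P ⊗[k] N` spanned by the elements `p r ⊗ n - p ⊗ r n`. -/
def balancedRel (R P N : Type*) [Ring R] [AddCommGroup P] [Module k P]
    [Module Rᵐᵒᵖ P] [AddCommGroup N] [Module k N] [Module R N] : Submodule k (P ⊗[k] N) :=
  Submodule.span k {z | ∃ (p : P) (r : R) (n : N),
    z = (MulOpposite.op r • p) ⊗ₜ[k] n - p ⊗ₜ[k] (r • n)}

/-- The tensor product `P ⊗_R N` of a right module `P` and a left module `N` over a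
(not necessarily commutative) `k`-algebra `R`. -/
abbrev BalancedTensor (R P N : Type*) [Ring R] [AddCommGroup P] [Module k P]
    [Module Rᵐᵒᵖ P] [AddCommGroup N] [Module k N] [Module R N] : Type _ :=
  (P ⊗[k] N) ⧸ balancedRel k R P N

/-- The map `P ⊗_R f : P ⊗_R N → P ⊗_R N'`. -/
noncomputable def BalancedTensor.map (R P : Type*) {N N' : Type*} [Ring R] [Algebra k R]
    [AddCommGroup P] [Module k P] [Module Rᵐᵒᵖ P] [AddCommGroup N] [Module k N] [Module R N]
    [IsScalarTower k R N] [AddCommGroup N'] [Module k N'] [Module R N'] [IsScalarTower k R N']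
    (f : N →ₗ[R] N') : BalancedTensor k R P N →ₗ[k] BalancedTensor k R P N' :=
  Submodule.mapQ _ _ ((f.restrictScalars k).lTensor P) (by
    rw [balancedRel, Submodule.span_le]
    rintro _ ⟨p, r, n, rfl⟩
    refine Submodule.subset_span ⟨p, r, f n, ?_⟩
    simp)

/-- The right `R`-module `P` is faithfully flat: `P ⊗_R -` preserves injectivity, and
`P ⊗_R N = 0` only if `N = 0`.  (Both conditions can be tested on left ideals of `R` and on cyclic
modules, so it is enough to let the modules range over the universe of `R`.) -/
def IsRightFaithfullyFlat (R : Type u) (P : Type*) [Ring R] [Algebra k R]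
    [AddCommGroup P] [Module k P] [Module Rᵐᵒᵖ P] : Prop :=
  (∀ (N N' : Type u) [AddCommGroup N] [Module k N] [Module R N] [IsScalarTower k R N]
      [AddCommGroup N'] [Module k N'] [Module R N'] [IsScalarTower k R N'] (f : N →ₗ[R] N'),
      Function.Injective f → Function.Injective (BalancedTensor.map k R P f)) ∧
  ∀ (N : Type u) [AddCommGroup N] [Module k N] [Module R N] [IsScalarTower k R N],
    Subsingleton (BalancedTensor k R P N) → Subsingleton N

/-- An algebra is a right module over each of its subalgebras, by right multiplication. -/
instance rightModule {A : Type*} [Ring A] [Algebra k A] (R : Subalgebra k A) :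
    Module Rᵐᵒᵖ A :=
  Module.compHom A (RingHom.op (R.val : R →+* A))

theorem op_smul_eq {A : Type*} [Ring A] [Algebra k A] (R : Subalgebra k A) (r : R) (a : A) :
    MulOpposite.op r • a = a * (r : A) := rfl

end Balanced

/-! ### Hopf-Galois extensions -/

section Galois

variable (k : Type*) (H : Type*) [CommRing k] [Ring H] [HopfAlgebra k H]

/-- The map `A ⊗[k] A → A ⊗ H`, `a ⊗ b ↦ a₀ b ⊗ a₁`. -/
noncomputable def preCan (A : Type*) [Ring A] [Algebra k A] [RightComodule k H A] :
    A ⊗[k] A →ₗ[k] A ⊗[k] H :=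
  TensorProduct.lift ((LinearMap.mul k (A ⊗[k] H)).compl₂
    (Algebra.TensorProduct.includeLeft : A →ₐ[k] A ⊗[k] H).toLinearMap ∘ₗ coact k H A)

theorem preCan_tmul (A : Type*) [Ring A] [Algebra k A] [RightComodule k H A] (a b : A) :
    preCan k H A (a ⊗ₜ b) = coact k H A a * (b ⊗ₜ[k] (1 : H)) := rfl

/-- The canonical map `A ⊗_{A^{co H}} A → A ⊗ H`, `a ⊗ b ↦ a₀ b ⊗ a₁`. -/
noncomputable def can (A : Type*) [Ring A] [Algebra k A] [RightComodule k H A]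
    [IsComoduleAlgebra k H A] :
    BalancedTensor k (coinvariants k H A) A A →ₗ[k] A ⊗[k] H :=
  Submodule.liftQ _ (preCan k H A) (by
    rw [balancedRel, Submodule.span_le]
    rintro _ ⟨a, r, b, rfl⟩
    have hr : coact k H A (r : A) = (r : A) ⊗ₜ[k] (1 : H) := r.2
    simp only [SetLike.mem_coe, LinearMap.mem_ker, map_sub, preCan_tmul]
    rw [op_smul_eq, IsComoduleAlgebra.coact_mul, hr, mul_assoc,
      Algebra.TensorProduct.tmul_mul_tmul, one_mul, Subalgebra.smul_def, smul_eq_mul, sub_self])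

/-- `A` is a right faithfully flat `H`-Galois extension of `A^{co H}`: the canonical map is
bijective, and `A` is faithfully flat as a right `A^{co H}`-module. -/
def IsRightFaithfullyFlatGalois (A : Type*) [Ring A] [Algebra k A] [RightComodule k H A]
    [IsComoduleAlgebra k H A] : Prop :=
  Function.Bijective (can k H A) ∧ IsRightFaithfullyFlat k (coinvariants k H A) A

end Galois

/-! ### The rational part of the endomorphism algebra of a relative Hopf module -/

section Rational

variable (k : Type*) (H : Type*) [CommRing k] [Ring H] [HopfAlgebra k H]

section Twist

variable {M V : Type*} [AddCommGroup M] [Module k M] [RightComodule k H M]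
  [AddCommGroup V] [Module k V]

/-- For `a : H → End V` and `F : M → V`, the map `m ↦ a(m₁) (F m₀)`. -/
noncomputable def twist (a : H →ₗ[k] V →ₗ[k] V) (F : M →ₗ[k] V) : M →ₗ[k] V :=
  TensorProduct.lift (a.flip ∘ₗ F) ∘ₗ coact k H M

theorem twist_twist (a b c : H →ₗ[k] V →ₗ[k] V) (F : M →ₗ[k] V)
    (hc : ∀ (h : H) (v : V), ∑ i ∈ (Coalgebra.Repr.arbitrary k h).index,
      a ((Coalgebra.Repr.arbitrary k h).right i)
        (b ((Coalgebra.Repr.arbitrary k h).left i) v) = c h v) :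
    twist k H a (twist k H b F) = twist k H c F := by
  have h1 : TensorProduct.lift (a.flip ∘ₗ twist k H b F) =
      TensorProduct.lift (a.flip ∘ₗ TensorProduct.lift (b.flip ∘ₗ F)) ∘ₗ
        (coact k H M).rTensor H := by
    ext; simp [twist]
  have h2 : TensorProduct.lift (a.flip ∘ₗ TensorProduct.lift (b.flip ∘ₗ F)) ∘ₗ
      (TensorProduct.assoc k M H H).symm.toLinearMap ∘ₗ
      (Coalgebra.comul : H →ₗ[k] H ⊗[k] H).lTensor M = TensorProduct.lift (c.flip ∘ₗ F) := by
    ext m h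
    have := (Coalgebra.Repr.arbitrary k h).eq
    simp [← this, TensorProduct.tmul_sum, hc]
  have h3 : (coact k H M).rTensor H ∘ₗ coact k H M =
      (TensorProduct.assoc k M H H).symm.toLinearMap ∘ₗ
      (Coalgebra.comul : H →ₗ[k] H ⊗[k] H).lTensor M ∘ₗ coact k H M := by
    rw [← RightComodule.coassoc]
    ext; simp
  calc twist k H a (twist k H b F)
      = TensorProduct.lift (a.flip ∘ₗ TensorProduct.lift (b.flip ∘ₗ F)) ∘ₗ
        ((coact k H M).rTensor H ∘ₗ coact k H M) := by
          rw [twist, h1]; rfl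
    _ = twist k H c F := by
          rw [h3, twist, ← h2]; rfl

theorem twist_counit (c : H →ₗ[k] V →ₗ[k] V) (F : M →ₗ[k] V)
    (hc : ∀ (h : H) (v : V), c h v = (Coalgebra.counit h : k) • v) : twist k H c F = F := by
  have h1 : TensorProduct.lift (c.flip ∘ₗ F) = F ∘ₗ (TensorProduct.rid k M).toLinearMap ∘ₗ
    (Coalgebra.counit : H →ₗ[k] k).lTensor M := by
    ext; simp [hc]
  have h0 := RightComodule.counit (k := k) (H := H) (M := M)
  calc twist k H c F = F ∘ₗ ((TensorProduct.rid k M).toLinearMap ∘ₗ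
      (Coalgebra.counit : H →ₗ[k] k).lTensor M ∘ₗ coact k H M) := by rw [twist, h1]; rfl
    _ = F := by rw [h0]; rfl

variable [BijectiveAntipode k H]

theorem antipode_antipodeInv (h : H) : HopfAlgebra.antipode k (antipodeInv k H h) = h :=
  (LinearEquiv.ofBijective (HopfAlgebra.antipode k : H →ₗ[k] H)
    BijectiveAntipode.bijective).apply_symm_apply h

theorem sum_antipodeInv_right_mul_left (h : H) :
    ∑ i ∈ (Coalgebra.Repr.arbitrary k h).index,
      antipodeInv k H ((Coalgebra.Repr.arbitrary k h).right i) *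
        (Coalgebra.Repr.arbitrary k h).left i = (Coalgebra.counit h : k) • (1 : H) := by
  apply (BijectiveAntipode.bijective (k := k) (H := H)).1
  simp only [map_sum, HopfAlgebra.antipode_mul_antidistrib, antipode_antipodeInv, map_smul,
    HopfAlgebra.antipode_one]
  exact HopfAlgebra.sum_antipode_mul_eq_smul _

theorem sum_right_mul_antipodeInv_left (h : H) :
    ∑ i ∈ (Coalgebra.Repr.arbitrary k h).index, (Coalgebra.Repr.arbitrary k h).right i *
      antipodeInv k H ((Coalgebra.Repr.arbitrary k h).left i) =
      (Coalgebra.counit h : k) • (1 : H) := by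
  apply (BijectiveAntipode.bijective (k := k) (H := H)).1
  simp only [map_sum, HopfAlgebra.antipode_mul_antidistrib, antipode_antipodeInv, map_smul,
    HopfAlgebra.antipode_one]
  exact HopfAlgebra.sum_mul_antipode_eq_smul _

theorem twist_antipodeInv_twist (a : H →ₐ[k] Module.End k V) (F : M →ₗ[k] V) :
    twist k H (a.toLinearMap ∘ₗ antipodeInv k H) (twist k H a.toLinearMap F) = F := by
  rw [twist_twist k H _ _ (LinearMap.lsmul k V ∘ₗ Coalgebra.counit), twist_counit]
  · intro h v; rfl
  · intro h v
    have := congrArg (fun g => a g v) (sum_antipodeInv_right_mul_left k H h)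
    simpa using this

theorem twist_twist_antipodeInv (a : H →ₐ[k] Module.End k V) (F : M →ₗ[k] V) :
    twist k H a.toLinearMap (twist k H (a.toLinearMap ∘ₗ antipodeInv k H) F) = F := by
  rw [twist_twist k H _ _ (LinearMap.lsmul k V ∘ₗ Coalgebra.counit), twist_counit]
  · intro h v; rfl
  · intro h v
    have := congrArg (fun g => a g v) (sum_right_mul_antipodeInv_left k H h)
    simpa using this

end Twist

section Nu

variable {M X W : Type*} [AddCommGroup M] [Module k M] [AddCommGroup X] [Module k X]
  [AddCommGroup W] [Module k W]

/-- For a `k`-module `X` of endomorphisms of `M`, the map `X ⊗ W → Hom(M, M ⊗ W)` sending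
`f ⊗ w` to `m ↦ f m ⊗ w`. -/
noncomputable def nu (W : Type*) [AddCommGroup W] [Module k W] (e : X →ₗ[k] M →ₗ[k] M) :
    X ⊗[k] W →ₗ[k] M →ₗ[k] M ⊗[k] W :=
  TensorProduct.rTensorHomToHomRTensor (RingHom.id k) M M W ∘ₗ e.rTensor W

theorem nu_tmul (e : X →ₗ[k] M →ₗ[k] M) (x : X) (w : W) (m : M) :
    nu k W e (x ⊗ₜ w) m = e x m ⊗ₜ w := by
  simp [nu]

theorem nu_injective [Module.Projective k W] (e : X →ₗ[k] M →ₗ[k] M)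
    (he : Function.Injective e) : Function.Injective (nu k W e) := by
  classical
  rw [injective_iff_map_eq_zero]
  intro t ht
  obtain ⟨s, hs⟩ := Module.projective_def'.1 (inferInstance : Module.Projective k W)
  have comp : ∀ w : W, (TensorProduct.rid k X) ((Finsupp.lapply w ∘ₗ s).lTensor X t) = 0 := by
    intro w
    apply he
    rw [map_zero]
    ext m
    have h1 : ∀ t : X ⊗[k] W, e ((TensorProduct.rid k X) ((Finsupp.lapply w ∘ₗ s).lTensor X t)) m =
        (TensorProduct.rid k M) ((Finsupp.lapply w ∘ₗ s).lTensor M (nu k W e t m)) := by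
      intro t
      induction t using TensorProduct.induction_on with
      | zero => simp
      | add x y hx hy => simp only [map_add, LinearMap.add_apply, hx, hy]
      | tmul x y => simp [nu_tmul]
    rw [h1, ht]
    simp
  have h2 : (TensorProduct.finsuppScalarRight k k X W) (s.lTensor X t) = 0 := by
    ext w
    rw [Finsupp.zero_apply, ← comp w]
    generalize t = t'
    induction t' using TensorProduct.induction_on with
    | zero => simp
    | add x y hx hy => simp only [map_add, Finsupp.add_apply, hx, hy]
    | tmul x y => simp
  have h3 : s.lTensor X t = 0 := by simpa using h2
  have h4 : (Finsupp.linearCombination k id ∘ₗ s).lTensor X t = 0 := by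
    rw [LinearMap.lTensor_comp, LinearMap.comp_apply, h3, map_zero]
  rwa [hs, LinearMap.lTensor_id] at h4

end Nu

set_option linter.unusedSectionVars false

section Coaction

variable {M V V' X W : Type*} [AddCommGroup M] [Module k M] [RightComodule k H M]
  [AddCommGroup V] [Module k V] [AddCommGroup V'] [Module k V']

theorem comp_twist (L : V →ₗ[k] V') (a : H →ₗ[k] V →ₗ[k] V) (a' : H →ₗ[k] V' →ₗ[k] V')
    (F : M →ₗ[k] V) (F' : M →ₗ[k] V') (h : ∀ g m, L (a g (F m)) = a' g (F' m)) :
    L ∘ₗ twist k H a F = twist k H a' F' := by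
  have h1 : L ∘ₗ TensorProduct.lift (a.flip ∘ₗ F) = TensorProduct.lift (a'.flip ∘ₗ F') := by
    ext; simp [h]
  rw [twist, twist, ← h1]; rfl

variable (M) in
/-- The action of `H` on `M ⊗ W` through an action of `H` on `W`. -/
noncomputable def rightFactorAct [AddCommGroup W] [Module k W] (b : H →ₐ[k] Module.End k W) :
    H →ₐ[k] Module.End k (M ⊗[k] W) :=
  (Module.End.lTensorAlgHom k W M).comp b

theorem rightFactorAct_tmul [AddCommGroup W] [Module k W] (b : H →ₐ[k] Module.End k W) (h : H)
    (m : M) (w : W) : rightFactorAct k H M b h (m ⊗ₜ w) = m ⊗ₜ b h w := rfl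

variable (M) in
/-- The action of `H` on `M ⊗ H` given by `h (m ⊗ g) = m ⊗ h g`. -/
noncomputable abbrev mulAct : H →ₐ[k] Module.End k (M ⊗[k] H) :=
  rightFactorAct k H M (Algebra.lmul k H)

variable (M) in
noncomputable abbrev diagMulAct : H →ₐ[k] Module.End k (M ⊗[k] (H ⊗[k] H)) :=
  rightFactorAct k H M ((Algebra.lmul k (H ⊗[k] H)).comp (Bialgebra.comulAlgHom k H))

variable (M) in
noncomputable abbrev sndMulAct : H →ₐ[k] Module.End k (M ⊗[k] (H ⊗[k] H)) :=
  rightFactorAct k H M ((Algebra.lmul k (H ⊗[k] H)).comp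
    (Algebra.TensorProduct.includeRight : H →ₐ[k] H ⊗[k] H))

variable (M) in
noncomputable abbrev fstMulAct : H →ₐ[k] Module.End k (M ⊗[k] (H ⊗[k] H)) :=
  rightFactorAct k H M ((Algebra.lmul k (H ⊗[k] H)).comp
    (Algebra.TensorProduct.includeLeft : H →ₐ[k] H ⊗[k] H))

theorem twist_snd_twist_fst (G : M →ₗ[k] M ⊗[k] (H ⊗[k] H)) :
    twist k H (sndMulAct k H M).toLinearMap (twist k H (fstMulAct k H M).toLinearMap G) =
      twist k H (diagMulAct k H M).toLinearMap G := by
  apply twist_twist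
  intro h v
  induction v using TensorProduct.induction_on with
  | zero => simp
  | add x y hx hy => simp only [map_add, Finset.sum_add_distrib, hx, hy]
  | tmul m w =>
    have he := (Coalgebra.Repr.arbitrary k h).eq
    simp only [AlgHom.toLinearMap_apply, rightFactorAct_tmul, AlgHom.comp_apply,
      Bialgebra.comulAlgHom_apply, ← he, map_sum, LinearMap.sum_apply, TensorProduct.tmul_sum]
    refine Finset.sum_congr rfl fun i _ => ?_
    simp [← mul_assoc]

variable (M) in
/-- The map `M ⊗ H → M ⊗ H ⊗ H`, `m ⊗ h ↦ m₀ ⊗ m₁ ⊗ h`. -/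
noncomputable abbrev coactLeft : M ⊗[k] H →ₗ[k] M ⊗[k] (H ⊗[k] H) :=
  (TensorProduct.assoc k M H H).toLinearMap ∘ₗ (coact k H M).rTensor H

theorem coactLeft_twist (F : M →ₗ[k] M ⊗[k] H) :
    coactLeft k H M ∘ₗ twist k H (mulAct k H M).toLinearMap F =
      twist k H (sndMulAct k H M).toLinearMap (coactLeft k H M ∘ₗ F) := by
  apply comp_twist
  intro g m
  simp only [LinearMap.comp_apply]
  generalize F m = y
  induction y using TensorProduct.induction_on with
  | zero => simp
  | add x y hx hy => simp only [map_add, hx, hy]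
  | tmul m h =>
    simp only [AlgHom.toLinearMap_apply, rightFactorAct_tmul, LinearMap.rTensor_tmul]
    generalize coact k H M m = z
    induction z using TensorProduct.induction_on with
    | zero => simp
    | add x y hx hy => simp only [map_add, TensorProduct.add_tmul, hx, hy]
    | tmul m' h' => simp [rightFactorAct_tmul]

variable [AddCommGroup X] [Module k X]

theorem comul_twist_nu (e : X →ₗ[k] M →ₗ[k] M) (t : X ⊗[k] H) :
    (Coalgebra.comul : H →ₗ[k] H ⊗[k] H).lTensor M ∘ₗ
        twist k H (mulAct k H M).toLinearMap (nu k H e t) =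
      twist k H (diagMulAct k H M).toLinearMap
        (nu k (H ⊗[k] H) e ((Coalgebra.comul : H →ₗ[k] H ⊗[k] H).lTensor X t)) := by
  apply comp_twist
  intro g m
  induction t using TensorProduct.induction_on with
  | zero => simp
  | add x y hx hy => simp only [map_add, LinearMap.add_apply, hx, hy]
  | tmul x h => simp [nu_tmul, rightFactorAct_tmul]

theorem assoc_nu_twist (e : X →ₗ[k] M →ₗ[k] M) (s : X ⊗[k] H) (g : H) (m : M) :
    TensorProduct.assoc k M H H (twist k H (mulAct k H M).toLinearMap (nu k H e s) m ⊗ₜ g) =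
      twist k H (fstMulAct k H M).toLinearMap
        (nu k (H ⊗[k] H) e (TensorProduct.assoc k X H H (s ⊗ₜ g))) m := by
  have := comp_twist k H ((TensorProduct.assoc k M H H).toLinearMap ∘ₗ
      (TensorProduct.mk k (M ⊗[k] H) H).flip g) (mulAct k H M).toLinearMap
      (fstMulAct k H M).toLinearMap (nu k H e s)
      (nu k (H ⊗[k] H) e (TensorProduct.assoc k X H H (s ⊗ₜ g))) (by
    intro g' m
    induction s using TensorProduct.induction_on with
    | zero => simp
    | add x y hx hy =>
      simp only [map_add, LinearMap.add_apply, TensorProduct.add_tmul, hx, hy]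
    | tmul x h => simp [nu_tmul, rightFactorAct_tmul])
  exact LinearMap.congr_fun this m

theorem twist_add (a : H →ₗ[k] V →ₗ[k] V) (F G : M →ₗ[k] V) :
    twist k H a (F + G) = twist k H a F + twist k H a G := by
  ext m
  simp only [twist, LinearMap.comp_apply, LinearMap.add_apply]
  induction coact k H M m using TensorProduct.induction_on with
  | zero => simp
  | add x y hx hy => simp only [map_add, hx, hy]; abel
  | tmul x h => simp

theorem twist_smul (a : H →ₗ[k] V →ₗ[k] V) (c : k) (F : M →ₗ[k] V) :
    twist k H a (c • F) = c • twist k H a F := by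
  ext m
  simp only [twist, LinearMap.comp_apply, LinearMap.smul_apply]
  induction coact k H M m using TensorProduct.induction_on with
  | zero => simp
  | add x y hx hy => simp only [map_add, smul_add, hx, hy]
  | tmul x h => simp

theorem twist_zero (a : H →ₗ[k] V →ₗ[k] V) : twist k H a (0 : M →ₗ[k] V) = 0 := by
  simpa using twist_smul k H a 0 (0 : M →ₗ[k] V)

variable [BijectiveAntipode k H]

theorem twist_injective (a : H →ₐ[k] Module.End k V) :
    Function.Injective (twist k H a.toLinearMap : (M →ₗ[k] V) → M →ₗ[k] V) :=
  Function.LeftInverse.injective (twist_antipodeInv_twist k H a)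

end Coaction

section Witness

variable {M X : Type*} [AddCommGroup M] [Module k M] [RightComodule k H M]
  [Ring X] [Algebra k X]

/-- For an algebra `X` acting on the right on `M` by `e`, the tensor `t = f₀ ⊗ f₁ : X ⊗ H` describes
the coaction of `f : X`: one has `ρ(f m) = f₀ (m₀) ⊗ m₁ f₁` for all `m`. -/
def Describes (e : X →ₗ[k] M →ₗ[k] M) (f : X) (t : X ⊗[k] H) : Prop :=
  coact k H M ∘ₗ e f = twist k H (mulAct k H M).toLinearMap (nu k H e t)

variable {k H}

theorem Describes.add {e : X →ₗ[k] M →ₗ[k] M} {f g : X} {s t : X ⊗[k] H}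
    (hs : Describes k H e f s) (ht : Describes k H e g t) : Describes k H e (f + g) (s + t) := by
  unfold Describes at *
  rw [map_add, map_add, twist_add, ← hs, ← ht, LinearMap.comp_add]

theorem Describes.smul {e : X →ₗ[k] M →ₗ[k] M} {f : X} {t : X ⊗[k] H}
    (ht : Describes k H e f t) (c : k) : Describes k H e (c • f) (c • t) := by
  unfold Describes at *
  rw [map_smul, map_smul, twist_smul, ← ht, LinearMap.comp_smul]

theorem Describes.mul {e : X →ₗ[k] M →ₗ[k] M} (he : ∀ x y, e (x * y) = e y ∘ₗ e x)
    {f g : X} {s t : X ⊗[k] H}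
    (hs : Describes k H e f s) (ht : Describes k H e g t) : Describes k H e (f * g) (s * t) := by
  unfold Describes at *
  rw [he, ← LinearMap.comp_assoc, ht, twist, LinearMap.comp_assoc, hs]
  apply comp_twist
  intro h m
  clear hs ht
  induction s using TensorProduct.induction_on with
  | zero => simp
  | add x y hx hy =>
    simp only [map_add, LinearMap.add_apply, add_mul, hx, hy]
  | tmul x g =>
    simp only [nu_tmul, AlgHom.toLinearMap_apply, rightFactorAct_tmul, TensorProduct.lift.tmul,
      LinearMap.comp_apply, LinearMap.flip_apply]
    induction t using TensorProduct.induction_on with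
    | zero => simp
    | add y z hy hz =>
      simp only [map_add, LinearMap.add_apply, mul_add, hy, hz]
    | tmul y g' => simp [nu_tmul, rightFactorAct_tmul, he]

theorem Describes.one {e : X →ₗ[k] M →ₗ[k] M} (he : e 1 = LinearMap.id) :
    Describes k H e 1 1 := by
  unfold Describes
  rw [he, LinearMap.comp_id, twist]
  have : TensorProduct.lift ((mulAct k H M).toLinearMap.flip ∘ₗ nu k H e 1) =
      LinearMap.id := by
    ext m h
    simp [nu_tmul, rightFactorAct_tmul, he, Algebra.TensorProduct.one_def]
  rw [this, LinearMap.id_comp]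

theorem Describes.counit {e : X →ₗ[k] M →ₗ[k] M} (he : Function.Injective e) {f : X}
    {t : X ⊗[k] H} (ht : Describes k H e f t) :
    TensorProduct.rid k X ((Coalgebra.counit : H →ₗ[k] k).lTensor X t) = f := by
  apply he
  have h0 := RightComodule.counit (k := k) (H := H) (M := M)
  have h1 : (TensorProduct.rid k M).toLinearMap ∘ₗ (Coalgebra.counit : H →ₗ[k] k).lTensor M ∘ₗ
      twist k H (mulAct k H M).toLinearMap (nu k H e t) =
      twist k H (LinearMap.lsmul k M ∘ₗ Coalgebra.counit)
        (e (TensorProduct.rid k X ((Coalgebra.counit : H →ₗ[k] k).lTensor X t))) := by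
    rw [← LinearMap.comp_assoc]
    apply comp_twist
    intro h m
    clear ht
    induction t using TensorProduct.induction_on with
    | zero => simp
    | add x y hx hy => simp only [map_add, LinearMap.add_apply, hx, hy]
    | tmul x g =>
      simp [nu_tmul, rightFactorAct_tmul, mul_smul]
      exact smul_comm _ _ _
  rw [twist_counit k H (LinearMap.lsmul k M ∘ₗ Coalgebra.counit) _ (fun _ _ => rfl), ← ht] at h1
  rw [← h1, ← LinearMap.comp_assoc, ← LinearMap.comp_assoc,
    LinearMap.comp_assoc _ _ (TensorProduct.rid k M).toLinearMap, h0, LinearMap.id_comp]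

theorem coactLeft_nu {e : X →ₗ[k] M →ₗ[k] M} (δ : X →ₗ[k] X ⊗[k] H)
    (hδ : ∀ f, Describes k H e f (δ f)) (s : X ⊗[k] H) :
    coactLeft k H M ∘ₗ nu k H e s = twist k H (fstMulAct k H M).toLinearMap
      (nu k (H ⊗[k] H) e (TensorProduct.assoc k X H H (δ.rTensor H s))) := by
  induction s using TensorProduct.induction_on with
  | zero => simp [twist_zero]
  | add x y hx hy => simp only [map_add, LinearMap.comp_add, twist_add, hx, hy]
  | tmul x g =>
    ext m
    rw [LinearMap.rTensor_tmul, ← assoc_nu_twist, ← hδ]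
    simp [nu_tmul]

theorem coact_coact_comp (F : M →ₗ[k] M) : coactLeft k H M ∘ₗ coact k H M ∘ₗ F =
    (Coalgebra.comul : H →ₗ[k] H ⊗[k] H).lTensor M ∘ₗ coact k H M ∘ₗ F := by
  rw [← LinearMap.comp_assoc, ← LinearMap.comp_assoc, ← RightComodule.coassoc]; rfl

variable [BijectiveAntipode k H] [Module.Projective k H]

theorem Describes.unique {e : X →ₗ[k] M →ₗ[k] M} (he : Function.Injective e) {f : X}
    {s t : X ⊗[k] H} (hs : Describes k H e f s) (ht : Describes k H e f t) : s = t :=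
  nu_injective k e he (twist_injective k H (mulAct k H M) (hs.symm.trans ht))

theorem coassoc_of_describes {e : X →ₗ[k] M →ₗ[k] M} (he : Function.Injective e)
    (δ : X →ₗ[k] X ⊗[k] H) (hδ : ∀ f, Describes k H e f (δ f)) :
    (TensorProduct.assoc k X H H).toLinearMap ∘ₗ δ.rTensor H ∘ₗ δ =
      (Coalgebra.comul : H →ₗ[k] H ⊗[k] H).lTensor X ∘ₗ δ := by
  ext1 f
  apply nu_injective k e he
  apply twist_injective k H (diagMulAct k H M)
  simp only [LinearMap.comp_apply, LinearEquiv.coe_coe]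
  rw [← comul_twist_nu, ← twist_snd_twist_fst, ← coactLeft_nu δ hδ, ← coactLeft_twist, ← hδ,
    coact_coact_comp]

/-- The components of a tensor describing the coaction of `f` have a coaction themselves. -/
theorem Describes.component {e : X →ₗ[k] M →ₗ[k] M} {f : X} {t : X ⊗[k] H}
    (ht : Describes k H e f t) (φ : H →ₗ[k] k) :
    Describes k H e (TensorProduct.rid k X (φ.lTensor X t))
      (((TensorProduct.rid k H).toLinearMap ∘ₗ φ.lTensor H ∘ₗ Coalgebra.comul).lTensor X t) := by
  have h1 : coactLeft k H M ∘ₗ nu k H e t = twist k H (fstMulAct k H M).toLinearMap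
      (nu k (H ⊗[k] H) e ((Coalgebra.comul : H →ₗ[k] H ⊗[k] H).lTensor X t)) := by
    apply twist_injective k H (sndMulAct k H M)
    rw [twist_snd_twist_fst, ← comul_twist_nu, ← coactLeft_twist, ← ht, coact_coact_comp]
  set L : M ⊗[k] (H ⊗[k] H) →ₗ[k] M ⊗[k] H :=
    ((TensorProduct.rid k H).toLinearMap ∘ₗ φ.lTensor H).lTensor M with hL
  have h2 : L ∘ₗ coactLeft k H M ∘ₗ nu k H e t =
      coact k H M ∘ₗ e (TensorProduct.rid k X (φ.lTensor X t)) := by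
    ext1 m
    clear ht h1
    induction t using TensorProduct.induction_on with
    | zero => simp
    | add x y hx hy =>
      simp only [LinearMap.comp_apply, map_add, LinearMap.add_apply] at hx hy ⊢
      rw [hx, hy]
    | tmul x g =>
      simp only [LinearMap.comp_apply, nu_tmul, LinearMap.rTensor_tmul, LinearMap.lTensor_tmul,
        TensorProduct.rid_tmul, map_smul, LinearMap.smul_apply]
      generalize coact k H M (e x m) = z
      induction z using TensorProduct.induction_on with
      | zero => simp
      | add x y hx hy => simp only [TensorProduct.add_tmul, map_add, smul_add, hx, hy]
      | tmul y h => simp [hL]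
  unfold Describes
  rw [← h2, h1]
  apply comp_twist
  intro h m
  clear h1 h2 ht
  induction t using TensorProduct.induction_on with
  | zero => simp
  | add x y hx hy => simp only [map_add, LinearMap.add_apply, hx, hy]
  | tmul x g =>
    simp only [LinearMap.lTensor_tmul, nu_tmul, AlgHom.toLinearMap_apply, rightFactorAct_tmul,
      LinearMap.comp_apply, hL, AlgHom.comp_apply]
    generalize (Coalgebra.comul : H →ₗ[k] H ⊗[k] H) g = z
    induction z using TensorProduct.induction_on with
    | zero => simp
    | add x y hx hy => simp only [TensorProduct.tmul_add, map_add, hx, hy]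
    | tmul y h => simp

/-- A tensor all of whose components lie in a submodule comes from that submodule. -/
theorem mem_range_of_components (p : Submodule k X) (t : X ⊗[k] H)
    (hp : ∀ φ : H →ₗ[k] k, TensorProduct.rid k X (φ.lTensor X t) ∈ p) :
    ∃ s : p ⊗[k] H, p.subtype.rTensor H s = t := by
  classical
  obtain ⟨s, hs⟩ := Module.projective_def'.1 (inferInstance : Module.Projective k H)
  set c := TensorProduct.finsuppScalarRight k k X H
  have h1 : ∀ y : X ⊗[k] (H →₀ k), (Finsupp.linearCombination k id).lTensor X y =
      (c y).sum fun w x => x ⊗ₜ[k] w := by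
    intro y
    induction y using TensorProduct.induction_on with
    | zero => simp
    | add x y hx hy =>
      rw [map_add, map_add, hx, hy, Finsupp.sum_add_index']
      · simp
      · simp [TensorProduct.add_tmul]
    | tmul x g =>
      induction g using Finsupp.induction_linear with
      | zero => simp
      | add f g hf hg =>
        rw [TensorProduct.tmul_add, map_add, map_add, hf, hg, Finsupp.sum_add_index']
        · simp
        · simp [TensorProduct.add_tmul]
      | single w r =>
        have : c (x ⊗ₜ[k] Finsupp.single w r) = Finsupp.single w (r • x) := by
          ext v
          by_cases hv : w = v
          · subst hv; simp [c]
          · simp [c, Finsupp.single_eq_of_ne' hv]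
        rw [this, Finsupp.sum_single_index (by simp)]
        simp [TensorProduct.smul_tmul]
  have h2 : ∀ (y : X ⊗[k] H) (w : H), c (s.lTensor X y) w =
      TensorProduct.rid k X ((Finsupp.lapply w ∘ₗ s).lTensor X y) := by
    intro y w
    induction y using TensorProduct.induction_on with
    | zero => simp
    | add x y hx hy => simp only [map_add, Finsupp.add_apply, hx, hy]
    | tmul x y => simp [c]
  have h3 : t = (c (s.lTensor X t)).sum fun w x => x ⊗ₜ[k] w := by
    rw [← h1, ← LinearMap.comp_apply, ← LinearMap.lTensor_comp, hs, LinearMap.lTensor_id,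
      LinearMap.id_apply]
  refine ⟨∑ w ∈ (c (s.lTensor X t)).support,
    (⟨c (s.lTensor X t) w, h2 t w ▸ hp _⟩ : p) ⊗ₜ[k] w, ?_⟩
  rw [map_sum]
  conv_rhs => rw [h3]
  rfl

end Witness

section EndAlgebra

variable (A M : Type*) [Ring A] [Algebra k A] [AddCommGroup M] [Module k M] [Module A M]
  [IsScalarTower k A M] [RightComodule k H M]

/-- For an endomorphism `f` of `M`, the map
`m ↦ f(m₀)₀ ⊗ S⁻¹(m₁) f(m₀)₁` from `M` to `M ⊗ H`. -/
noncomputable def rhoTilde {M : Type*} [AddCommGroup M] [Module k M] [RightComodule k H M]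
    [BijectiveAntipode k H] (f : M →ₗ[k] M) : M →ₗ[k] M ⊗[k] H :=
  twist k H ((mulAct k H M).toLinearMap ∘ₗ antipodeInv k H) (coact k H M ∘ₗ f)

/-- `A`-linear endomorphisms as `k`-linear maps. -/
def endToHom : Module.End A M →ₗ[k] M →ₗ[k] M where
  toFun f := f.restrictScalars k
  map_add' _ _ := rfl
  map_smul' _ _ := rfl

/-- The `A`-linear endomorphism `f` of `M` is rational: there is
`f₀ ⊗ f₁ ∈ End_A(M) ⊗ H` with `f₀(m) ⊗ f₁ = f(m₀)₀ ⊗ S⁻¹(m₁) f(m₀)₁` for all `m`. -/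
def IsRational [BijectiveAntipode k H] (f : Module.End A M) : Prop :=
  ∃ t : Module.End A M ⊗[k] H, nu k H (endToHom k A M) t = rhoTilde k H (f.restrictScalars k)

/-- The opposite of the algebra of `A`-linear endomorphisms of `M`, acting on `M`. -/
noncomputable def endOpToHom : (Module.End A M)ᵐᵒᵖ →ₗ[k] M →ₗ[k] M :=
  endToHom k A M ∘ₗ (MulOpposite.opLinearEquiv k).symm.toLinearMap

theorem endOpToHom_injective : Function.Injective (endOpToHom k A M) := by
  intro b c h
  apply MulOpposite.unop_injective
  ext m
  exact LinearMap.congr_fun h m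

theorem endOpToHom_mul (b c : (Module.End A M)ᵐᵒᵖ) :
    endOpToHom k A M (b * c) = endOpToHom k A M c ∘ₗ endOpToHom k A M b := rfl

theorem endOpToHom_one : endOpToHom k A M 1 = LinearMap.id := rfl

variable {A M} in
theorem isRational_unop_iff [BijectiveAntipode k H] (b : (Module.End A M)ᵐᵒᵖ) :
    IsRational k H A M b.unop ↔ ∃ t : (Module.End A M)ᵐᵒᵖ ⊗[k] H,
      Describes k H (endOpToHom k A M) b t := by
  have h1 : ∀ t : (Module.End A M)ᵐᵒᵖ ⊗[k] H, nu k H (endOpToHom k A M) t =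
      nu k H (endToHom k A M)
        ((MulOpposite.opLinearEquiv k).symm.toLinearMap.rTensor H t) := by
    intro t
    ext m
    induction t using TensorProduct.induction_on with
    | zero => simp
    | add x y hx hy => simp only [map_add, LinearMap.add_apply, hx, hy]
    | tmul x h => simp [nu_tmul, endOpToHom]
  have h2 : ∀ t : (Module.End A M)ᵐᵒᵖ ⊗[k] H, Describes k H (endOpToHom k A M) b t ↔
      nu k H (endOpToHom k A M) t = rhoTilde k H (b.unop.restrictScalars k) := by
    intro t
    constructor
    · intro h
      have h' : coact k H M ∘ₗ b.unop.restrictScalars k =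
        twist k H (mulAct k H M).toLinearMap (nu k H (endOpToHom k A M) t) := h
      rw [rhoTilde, h', twist_antipodeInv_twist]
    · intro h
      rw [Describes, h, rhoTilde, twist_twist_antipodeInv]
      rfl
  constructor
  · rintro ⟨t, ht⟩
    refine ⟨(MulOpposite.opLinearEquiv k).toLinearMap.rTensor H t, (h2 _).2 ?_⟩
    rw [h1, ← ht]
    clear ht
    congr 1
    induction t using TensorProduct.induction_on with
    | zero => simp
    | add x y hx hy => simp only [map_add, hx, hy]
    | tmul x h => simp
  · rintro ⟨t, ht⟩
    exact ⟨_, (h1 t).symm.trans ((h2 t).1 ht)⟩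

/-- The algebra `END_A(M)ᵒᵖ`: the opposite of the algebra of rational `A`-linear endomorphisms
of `M`. -/
def rationalEndOp [BijectiveAntipode k H] : Subalgebra k (Module.End A M)ᵐᵒᵖ where
  carrier := {b | IsRational k H A M b.unop}
  mul_mem' := by
    intro b c hb hc
    obtain ⟨s, hs⟩ := (isRational_unop_iff k H b).1 hb
    obtain ⟨t, ht⟩ := (isRational_unop_iff k H c).1 hc
    exact (isRational_unop_iff k H _).2 ⟨s * t, hs.mul (endOpToHom_mul k A M) ht⟩
  add_mem' := by
    intro b c hb hc
    obtain ⟨s, hs⟩ := (isRational_unop_iff k H b).1 hb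
    obtain ⟨t, ht⟩ := (isRational_unop_iff k H c).1 hc
    exact (isRational_unop_iff k H _).2 ⟨s + t, hs.add ht⟩
  algebraMap_mem' := by
    intro r
    refine (isRational_unop_iff k H _).2 ⟨r • 1, ?_⟩
    rw [Algebra.algebraMap_eq_smul_one]
    exact (Describes.one (endOpToHom_one k A M)).smul r

/-- The right action of `END_A(M)ᵒᵖ` on `M`. -/
noncomputable def rationalEndOpToHom [BijectiveAntipode k H] :
    rationalEndOp k H A M →ₗ[k] M →ₗ[k] M :=
  endOpToHom k A M ∘ₗ (rationalEndOp k H A M).val.toLinearMap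

theorem rationalEndOpToHom_apply [BijectiveAntipode k H] (b : rationalEndOp k H A M) (m : M) :
    rationalEndOpToHom k H A M b m = (b : (Module.End A M)ᵐᵒᵖ).unop m := rfl

variable [BijectiveAntipode k H]

theorem rationalEndOpToHom_injective : Function.Injective (rationalEndOpToHom k H A M) :=
  (endOpToHom_injective k A M).comp Subtype.val_injective

variable [Module.Projective k H]

variable {A M} in
theorem exists_describes (b : rationalEndOp k H A M) :
    ∃ s : rationalEndOp k H A M ⊗[k] H, Describes k H (rationalEndOpToHom k H A M) b s := by
  obtain ⟨t, ht⟩ := (isRational_unop_iff k H (b : (Module.End A M)ᵐᵒᵖ)).1 b.2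
  obtain ⟨s, hs⟩ := mem_range_of_components
    (Subalgebra.toSubmodule (rationalEndOp k H A M)) t
    (fun φ => (isRational_unop_iff k H _).2 ⟨_, ht.component φ⟩)
  refine ⟨s, ?_⟩
  have h1 : ∀ s : rationalEndOp k H A M ⊗[k] H, nu k H (rationalEndOpToHom k H A M) s =
      nu k H (endOpToHom k A M) ((rationalEndOp k H A M).val.toLinearMap.rTensor H s) := by
    intro s
    ext m
    induction s using TensorProduct.induction_on with
    | zero => simp
    | add x y hx hy => simp only [map_add, LinearMap.add_apply, hx, hy]
    | tmul x h => simp [nu_tmul, rationalEndOpToHom]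
  have h2 : nu k H (rationalEndOpToHom k H A M) s = nu k H (endOpToHom k A M) t := by
    rw [h1, ← hs]; rfl
  rw [Describes, h2]
  exact ht

/-- The coaction `f ↦ f₀ ⊗ f₁` on `END_A(M)ᵒᵖ`; see `nu_rationalEndOpCoact` for the formula that
determines it. -/
noncomputable def rationalEndOpCoact :
    rationalEndOp k H A M →ₗ[k] rationalEndOp k H A M ⊗[k] H where
  toFun b := (exists_describes k H b).choose
  map_add' b c := (exists_describes k H (b + c)).choose_spec.unique
    (rationalEndOpToHom_injective k H A M)
    ((exists_describes k H b).choose_spec.add (exists_describes k H c).choose_spec)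
  map_smul' r b := (exists_describes k H (r • b)).choose_spec.unique
    (rationalEndOpToHom_injective k H A M)
    ((exists_describes k H b).choose_spec.smul r)

variable {A M} in
theorem describes_rationalEndOpCoact (b : rationalEndOp k H A M) :
    Describes k H (rationalEndOpToHom k H A M) b (rationalEndOpCoact k H A M b) :=
  (exists_describes k H b).choose_spec

/-- The coaction on `END_A(M)ᵒᵖ` is determined by
`f₀(m) ⊗ f₁ = f(m₀)₀ ⊗ S⁻¹(m₁) f(m₀)₁`. -/
theorem nu_rationalEndOpCoact (b : rationalEndOp k H A M) :
    nu k H (rationalEndOpToHom k H A M) (rationalEndOpCoact k H A M b) =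
      rhoTilde k H ((b : (Module.End A M)ᵐᵒᵖ).unop.restrictScalars k) := by
  have h : coact k H M ∘ₗ (b : (Module.End A M)ᵐᵒᵖ).unop.restrictScalars k = _ :=
    describes_rationalEndOpCoact k H b
  rw [rhoTilde, h, twist_antipodeInv_twist]

/-- `END_A(M)ᵒᵖ` is a right comodule. -/
noncomputable instance rationalEndOpComodule : RightComodule k H (rationalEndOp k H A M) where
  coact := rationalEndOpCoact k H A M
  coassoc := coassoc_of_describes (rationalEndOpToHom_injective k H A M) _
    (describes_rationalEndOpCoact k H)
  counit := by
    ext1 b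
    exact (describes_rationalEndOpCoact k H b).counit (rationalEndOpToHom_injective k H A M)

/-- `END_A(M)ᵒᵖ` is a right comodule algebra. -/
instance rationalEndOp_isComoduleAlgebra : IsComoduleAlgebra k H (rationalEndOp k H A M) where
  coact_one := (describes_rationalEndOpCoact k H 1).unique
    (rationalEndOpToHom_injective k H A M) (Describes.one rfl)
  coact_mul b c := (describes_rationalEndOpCoact k H (b * c)).unique
    (rationalEndOpToHom_injective k H A M)
    ((describes_rationalEndOpCoact k H b).mul (fun _ _ => rfl)
      (describes_rationalEndOpCoact k H c))

end EndAlgebra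

end Rational

/-! ### Progenerators -/

section Progenerator

/-- `M` is a direct summand of a finite direct sum of copies of `N`, as an `A`-module. -/
def IsSummandOfPower (A M N : Type*) [Ring A] [AddCommGroup M] [Module A M] [AddCommGroup N]
    [Module A N] : Prop :=
  ∃ (n : ℕ) (i : M →ₗ[A] (Fin n → N)) (p : (Fin n → N) →ₗ[A] M), p ∘ₗ i = LinearMap.id

/-- `M` is a progenerator as a left `A`-module: `A` and `M` are mutually direct summands of finite
direct sums of copies of each other. -/
def IsProgenerator (A M : Type*) [Ring A] [AddCommGroup M] [Module A M] : Prop :=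
  IsSummandOfPower A M A ∧ IsSummandOfPower A A M

variable (k : Type*) (H : Type*) [CommRing k] [Ring H] [HopfAlgebra k H]

/-- A map of right comodules is `H`-colinear if `ρ(f(m)) = f(m₀) ⊗ m₁`. -/
def IsColinear {M N : Type*} [AddCommGroup M] [Module k M] [RightComodule k H M]
    [AddCommGroup N] [Module k N] [RightComodule k H N] (f : M →ₗ[k] N) : Prop :=
  coact k H N ∘ₗ f = f.rTensor H ∘ₗ coact k H M

/-- `M` is a direct summand of a finite direct sum of copies of `N` in the category of relative
Hopf modules, whose morphisms are the `A`-linear and `H`-colinear maps.  (A colinear idempotent of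
a relative Hopf module splits it into a direct sum of relative Hopf modules, so the existence of a
section and a retraction in the category is the same as that of a complement.) -/
def IsHopfSummandOfPower (A M N : Type*) [Ring A] [Algebra k A]
    [AddCommGroup M] [Module k M] [Module A M] [IsScalarTower k A M] [RightComodule k H M]
    [AddCommGroup N] [Module k N] [Module A N] [IsScalarTower k A N] [RightComodule k H N] :
    Prop :=
  ∃ (n : ℕ) (i : M →ₗ[A] (Fin n → N)) (p : (Fin n → N) →ₗ[A] M),
    IsColinear k H (i.restrictScalars k) ∧ IsColinear k H (p.restrictScalars k) ∧
    p ∘ₗ i = LinearMap.id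

/-- `M` is an `H`-progenerator: `A` and `M` are mutually direct summands of finite direct sums of
copies of each other in the category of relative Hopf modules. -/
def IsHopfProgenerator (A M : Type*) [Ring A] [Algebra k A] [RightComodule k H A]
    [IsComoduleAlgebra k H A] [AddCommGroup M] [Module k M] [Module A M] [IsScalarTower k A M]
    [RightComodule k H M] [IsHopfModule k H A M] : Prop :=
  IsHopfSummandOfPower k H A M A ∧ IsHopfSummandOfPower k H A A M

end Progenerator

end HopfGalois

namespace HopfGalois

/-! ### The tensor product over a noncommutative algebra -/

namespace BalancedTensor

section General

variable (k : Type*) [CommRing k] {R P N Y : Type*} [Ring R] [AddCommGroup P] [Module k P]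
  [Module Rᵐᵒᵖ P] [AddCommGroup N] [Module k N] [Module R N] [AddCommGroup Y] [Module k Y]

variable (R) in
/-- The class of `p ⊗ n` in `P ⊗_R N`. -/
def tmul (p : P) (n : N) : BalancedTensor k R P N :=
  Submodule.Quotient.mk (p ⊗ₜ[k] n)

theorem op_smul_tmul (r : R) (p : P) (n : N) :
    tmul k R (MulOpposite.op r • p) n = tmul k R p (r • n) :=
  (Submodule.Quotient.eq _).2 (Submodule.subset_span ⟨p, r, n, rfl⟩)

theorem tmul_add (p : P) (n n' : N) : tmul k R p (n + n') = tmul k R p n + tmul k R p n' := by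
  rw [tmul, TensorProduct.tmul_add]; rfl

theorem add_tmul (p p' : P) (n : N) : tmul k R (p + p') n = tmul k R p n + tmul k R p' n := by
  rw [tmul, TensorProduct.add_tmul]; rfl

theorem tmul_smul (c : k) (p : P) (n : N) : tmul k R p (c • n) = c • tmul k R p n := by
  rw [tmul, TensorProduct.tmul_smul]; rfl

theorem smul_tmul (c : k) (p : P) (n : N) : tmul k R (c • p) n = c • tmul k R p n := by
  rw [tmul, ← TensorProduct.smul_tmul']; rfl

variable (R P N) in
/-- The bilinear map `p, n ↦ p ⊗ n`. -/
def mk : P →ₗ[k] N →ₗ[k] BalancedTensor k R P N :=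
  LinearMap.mk₂ k (tmul k R) (fun p p' n => add_tmul k p p' n) (fun c p n => smul_tmul k c p n)
    (fun p n n' => tmul_add k p n n') (fun c p n => tmul_smul k c p n)

theorem mk_apply (p : P) (n : N) : mk k R P N p n = tmul k R p n := rfl

theorem tmul_zero (p : P) : tmul k R p (0 : N) = 0 := map_zero (mk k R P N p)

theorem tmul_sum {ι : Type*} (s : Finset ι) (p : P) (n : ι → N) :
    tmul k R p (∑ i ∈ s, n i) = ∑ i ∈ s, tmul k R p (n i) := map_sum (mk k R P N p) n s

theorem sum_tmul {ι : Type*} (s : Finset ι) (p : ι → P) (n : N) :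
    tmul k R (∑ i ∈ s, p i) n = ∑ i ∈ s, tmul k R (p i) n :=
  map_sum ((mk k R P N).flip n) p s

variable {k}

/-- A balanced bilinear map induces a map on the tensor product over `R`. -/
def lift (f : P →ₗ[k] N →ₗ[k] Y)
    (hf : ∀ (p : P) (r : R) (n : N), f (MulOpposite.op r • p) n = f p (r • n)) :
    BalancedTensor k R P N →ₗ[k] Y :=
  Submodule.liftQ _ (TensorProduct.lift f) (by
    rw [balancedRel, Submodule.span_le]
    rintro _ ⟨p, r, n, rfl⟩
    simp [hf])

theorem lift_tmul (f : P →ₗ[k] N →ₗ[k] Y) (hf) (p : P) (n : N) :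
    lift (R := R) f hf (tmul k R p n) = f p n := by
  simp [lift, tmul]

theorem hom_ext {f g : BalancedTensor k R P N →ₗ[k] Y}
    (h : ∀ p n, f (tmul k R p n) = g (tmul k R p n)) : f = g :=
  Submodule.linearMap_qext _ (TensorProduct.ext' h)

theorem induction_on {motive : BalancedTensor k R P N → Prop} (z : BalancedTensor k R P N)
    (zero : motive 0) (tmul : ∀ p n, motive (tmul k R p n))
    (add : ∀ x y, motive x → motive y → motive (x + y)) : motive z := by
  obtain ⟨t, rfl⟩ := Submodule.Quotient.mk_surjective _ z
  induction t using TensorProduct.induction_on with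
  | zero => exact zero
  | tmul p n => exact tmul p n
  | add x y hx hy => exact add _ _ hx hy

variable (k) in
/-- The map `g ⊗_R N : P ⊗_R N → P' ⊗_R N` induced by a map of right `R`-modules. -/
def mapLeft {P' : Type*} [AddCommGroup P'] [Module k P'] [Module Rᵐᵒᵖ P'] (N : Type*)
    [AddCommGroup N] [Module k N] [Module R N] (g : P →ₗ[k] P')
    (hg : ∀ (r : R) (p : P), g (MulOpposite.op r • p) = MulOpposite.op r • g p) :
    BalancedTensor k R P N →ₗ[k] BalancedTensor k R P' N :=
  lift (mk k R P' N ∘ₗ g) (by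
    intro p r n
    simp only [LinearMap.comp_apply, hg, mk_apply, op_smul_tmul])

theorem mapLeft_tmul {P' : Type*} [AddCommGroup P'] [Module k P'] [Module Rᵐᵒᵖ P']
    (g : P →ₗ[k] P') (hg) (p : P) (n : N) :
    mapLeft k N g hg (tmul k R p n) = tmul k R (g p) n :=
  lift_tmul _ _ _ _

end General

section Map

variable (k : Type*) [CommRing k] {R P N N' : Type*} [Ring R] [Algebra k R] [AddCommGroup P]
  [Module k P] [Module Rᵐᵒᵖ P] [AddCommGroup N] [Module k N] [Module R N] [IsScalarTower k R N]
  [AddCommGroup N'] [Module k N'] [Module R N'] [IsScalarTower k R N']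

theorem map_tmul (f : N →ₗ[R] N') (p : P) (n : N) :
    map k R P f (tmul k R p n) = tmul k R p (f n) := by
  simp [map, tmul]

theorem map_comp {N'' : Type*} [AddCommGroup N''] [Module k N''] [Module R N'']
    [IsScalarTower k R N''] (g : N' →ₗ[R] N'') (f : N →ₗ[R] N') :
    map k R P (g ∘ₗ f) = map k R P g ∘ₗ map k R P f :=
  hom_ext fun p n => by simp [map_tmul]

end Map

end BalancedTensor

open BalancedTensor

/-! ### The canonical map of a module over a comodule algebra -/

section CanonicalMap

variable (k : Type*) (H : Type*) [CommRing k] [Ring H] [HopfAlgebra k H]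
  (A : Type*) [Ring A] [Algebra k A] [RightComodule k H A] [IsComoduleAlgebra k H A]
  (X : Type*) [AddCommGroup X] [Module k X] [Module A X] [IsScalarTower k A X]

theorem diagAct_tmul {A X : Type*} [Ring A] [Algebra k A] [AddCommGroup X] [Module k X]
    [Module A X] [IsScalarTower k A X] (a : A) (h : H) (x : X) (g : H) :
    diagAct k H A X (a ⊗ₜ h) (x ⊗ₜ g) = (a • x) ⊗ₜ (h * g) := by
  simp [diagAct]

variable {A} in
theorem coact_coinvariant (r : coinvariants k H A) : coact k H A r = (r : A) ⊗ₜ 1 := r.2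

/-- The map `A ⊗_R X → X ⊗ H`, `a ⊗ x ↦ a₀ x ⊗ a₁`, where `R` is the algebra of coinvariants. -/
noncomputable def canModule : BalancedTensor k (coinvariants k H A) A X →ₗ[k] X ⊗[k] H :=
  BalancedTensor.lift ((diagAct k H A X ∘ₗ coact k H A).compl₂ ((TensorProduct.mk k X H).flip 1))
    (by
      intro a r x
      simp only [LinearMap.compl₂_apply, LinearMap.comp_apply, LinearMap.flip_apply,
        TensorProduct.mk_apply, op_smul_eq, IsComoduleAlgebra.coact_mul, coact_coinvariant]
      induction coact k H A a using TensorProduct.induction_on with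
      | zero => simp
      | add y z hy hz => simp only [add_mul, map_add, LinearMap.add_apply, hy, hz]
      | tmul b h => simp [diagAct_tmul, mul_smul, Subalgebra.smul_def])

theorem canModule_tmul (a : A) (x : X) :
    canModule k H A X (tmul k _ a x) = diagAct k H A X (coact k H A a) (x ⊗ₜ 1) :=
  lift_tmul _ _ _ _

/-- The map `z, x ↦ z x` from `(A ⊗_R A) × X` to `A ⊗_R X`. -/
noncomputable def balancedAct : BalancedTensor k (coinvariants k H A) A A →ₗ[k] X →ₗ[k]
    BalancedTensor k (coinvariants k H A) A X :=
  BalancedTensor.lift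
    (LinearMap.mk₂ k (fun a b => BalancedTensor.mk k (coinvariants k H A) A X a ∘ₗ
        (Algebra.lsmul k k X : A →ₐ[k] Module.End k X) b)
      (by intros; ext; simp) (by intros; ext; simp) (by intros; ext; simp) (by intros; ext; simp))
    (by
      intro a r b
      ext x
      simp [mk_apply, op_smul_tmul, Subalgebra.smul_def])

theorem balancedAct_tmul (a b : A) (x : X) :
    balancedAct k H A X (tmul k _ a b) x = tmul k _ a (b • x) := by
  simp [balancedAct, lift_tmul, mk_apply]

theorem can_tmul (a b : A) : can k H A (tmul k _ a b) = coact k H A a * (b ⊗ₜ 1) := by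
  simp [can, tmul, preCan_tmul]

theorem canModule_balancedAct (z : BalancedTensor k (coinvariants k H A) A A) (x : X) :
    canModule k H A X (balancedAct k H A X z x) = diagAct k H A X (can k H A z) (x ⊗ₜ 1) := by
  induction z using BalancedTensor.induction_on with
  | zero => simp
  | add y z hy hz => simp only [map_add, LinearMap.add_apply, hy, hz]
  | tmul a b =>
    rw [balancedAct_tmul, canModule_tmul, can_tmul]
    induction coact k H A a using TensorProduct.induction_on with
    | zero => simp
    | add y z hy hz => simp only [map_add, LinearMap.add_apply, hy, hz, add_mul]
    | tmul b h => simp [diagAct_tmul, mul_smul]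

variable {k H A}

theorem canModule_surjective (hA : Function.Bijective (can k H A)) :
    Function.Surjective (canModule k H A X) := by
  intro y
  induction y using TensorProduct.induction_on with
  | zero => exact ⟨0, map_zero _⟩
  | add y z hy hz =>
    obtain ⟨y', rfl⟩ := hy
    obtain ⟨z', rfl⟩ := hz
    exact ⟨y' + z', map_add _ _ _⟩
  | tmul x h =>
    obtain ⟨z, hz⟩ := hA.2 (1 ⊗ₜ h)
    exact ⟨balancedAct k H A X z x, by simp [canModule_balancedAct, hz, diagAct_tmul]⟩

/-- Right multiplication by `b` on the second factor of `A ⊗_R A`. -/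
noncomputable def balancedMulRight (b : A) : BalancedTensor k (coinvariants k H A) A A →ₗ[k]
    BalancedTensor k (coinvariants k H A) A A :=
  (balancedAct k H A A).flip b

theorem can_balancedMulRight (b : A) (z : BalancedTensor k (coinvariants k H A) A A) :
    can k H A (balancedMulRight b z) = can k H A z * (b ⊗ₜ 1) := by
  induction z using BalancedTensor.induction_on with
  | zero => simp
  | add y z hy hz => simp only [map_add, hy, hz, add_mul]
  | tmul a c =>
    rw [balancedMulRight, LinearMap.flip_apply, balancedAct_tmul, can_tmul, can_tmul, mul_assoc]
    simp

theorem balancedAct_balancedMulRight (b : A) (z : BalancedTensor k (coinvariants k H A) A A)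
    (x : X) : balancedAct k H A X (balancedMulRight b z) x = balancedAct k H A X z (b • x) := by
  induction z using BalancedTensor.induction_on with
  | zero => simp
  | add y z hy hz => simp only [map_add, LinearMap.add_apply, hy, hz]
  | tmul a c =>
    rw [balancedMulRight, LinearMap.flip_apply, balancedAct_tmul, balancedAct_tmul,
      balancedAct_tmul, smul_eq_mul, mul_smul]

theorem canModule_injective (hA : Function.Bijective (can k H A)) :
    Function.Injective (canModule k H A X) := by
  set e := LinearEquiv.ofBijective (can k H A) hA
  have he : ∀ z, can k H A (e.symm z) = z := e.apply_symm_apply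
  have he' : ∀ z, e.symm (can k H A z) = z := e.symm_apply_apply
  set inv : X ⊗[k] H →ₗ[k] BalancedTensor k (coinvariants k H A) A X :=
    TensorProduct.lift ((balancedAct k H A X ∘ₗ e.symm.toLinearMap ∘ₗ
      (Algebra.TensorProduct.includeRight : H →ₐ[k] A ⊗[k] H).toLinearMap).flip) with hinv
  have key : ∀ (y : A ⊗[k] H) (x : X),
      inv (diagAct k H A X y (x ⊗ₜ 1)) = balancedAct k H A X (e.symm y) x := by
    intro y x
    induction y using TensorProduct.induction_on with
    | zero => simp
    | add y z hy hz => simp only [map_add, LinearMap.add_apply, hy, hz]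
    | tmul a h =>
      have : e.symm (a ⊗ₜ h) = balancedMulRight a (e.symm (1 ⊗ₜ h)) := by
        apply hA.1
        rw [he, can_balancedMulRight, he]
        simp
      rw [this, balancedAct_balancedMulRight, diagAct_tmul]
      simp [hinv]
  have hl : inv ∘ₗ canModule k H A X = LinearMap.id := by
    refine BalancedTensor.hom_ext fun a x => ?_
    have h1 : coact k H A a = can k H A (tmul k _ a 1) := by
      rw [can_tmul, ← Algebra.TensorProduct.one_def, mul_one]
    rw [LinearMap.comp_apply, canModule_tmul, key, h1, he', balancedAct_tmul, one_smul]; rfl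
  exact Function.LeftInverse.injective (fun z => LinearMap.congr_fun hl z)

/-- The map `A ⊗_R X → X`, `a ⊗ x ↦ a x`. -/
noncomputable def balancedSmul (k H A : Type*) [CommRing k] [Ring H] [HopfAlgebra k H]
    [Ring A] [Algebra k A] [RightComodule k H A] [IsComoduleAlgebra k H A]
    (X : Type*) [AddCommGroup X] [Module k X] [Module A X] [IsScalarTower k A X] :
    BalancedTensor k (coinvariants k H A) A X →ₗ[k] X :=
  BalancedTensor.lift (Algebra.lsmul k k X : A →ₐ[k] Module.End k X).toLinearMap (by
    intro a r x
    simp [op_smul_eq, Subalgebra.smul_def])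

theorem balancedSmul_tmul (a : A) (x : X) : balancedSmul k H A X (tmul k _ a x) = a • x := by
  exact lift_tmul _ _ a x

theorem rid_counit_coact {M : Type*} [AddCommGroup M] [Module k M] [RightComodule k H M] (m : M) :
    TensorProduct.rid k M ((Coalgebra.counit : H →ₗ[k] k).lTensor M (coact k H M m)) = m :=
  LinearMap.congr_fun (RightComodule.counit (k := k) (H := H) (M := M)) m

theorem rid_counit_canModule (z : BalancedTensor k (coinvariants k H A) A X) :
    TensorProduct.rid k X ((Coalgebra.counit : H →ₗ[k] k).lTensor X (canModule k H A X z)) =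
      balancedSmul k H A X z := by
  induction z using BalancedTensor.induction_on with
  | zero => simp
  | add y z hy hz => simp only [map_add, hy, hz]
  | tmul a x =>
    rw [balancedSmul_tmul, canModule_tmul]
    conv_rhs => rw [← rid_counit_coact (k := k) (H := H) a]
    induction coact k H A a using TensorProduct.induction_on with
    | zero => simp
    | add y z hy hz => simp only [map_add, LinearMap.add_apply, add_smul, hy, hz]
    | tmul b h => simp [diagAct_tmul]

end CanonicalMap

/-! ### Relative Hopf modules are generated by their coinvariants -/

section Coinvariants

variable {k H : Type*} [CommRing k] [Ring H] [HopfAlgebra k H] [BijectiveAntipode k H]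

section Comodule

variable (k H) (M : Type*) [AddCommGroup M] [Module k M] [RightComodule k H M]

/-- The map `M ⊗ H → M ⊗ H`, `m ⊗ h ↦ m₀ ⊗ S⁻¹(h) m₁`. -/
noncomputable def coactAntipodeInv : M ⊗[k] H →ₗ[k] M ⊗[k] H :=
  TensorProduct.lift (((mulAct k H M).toLinearMap ∘ₗ antipodeInv k H).flip ∘ₗ coact k H M)

theorem coactAntipodeInv_comp_coact :
    coactAntipodeInv k H M ∘ₗ coact k H M = (TensorProduct.mk k M H).flip 1 := by
  have h1 : coact k H M =
      twist k H (mulAct k H M).toLinearMap ((TensorProduct.mk k M H).flip 1) := by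
    rw [twist]
    have : TensorProduct.lift ((mulAct k H M).toLinearMap.flip ∘ₗ
        (TensorProduct.mk k M H).flip 1) = LinearMap.id := by
      ext m h
      simp [rightFactorAct_tmul]
    rw [this, LinearMap.id_comp]
  have h2 := twist_antipodeInv_twist k H (mulAct k H M) ((TensorProduct.mk k M H).flip 1)
  rwa [← h1] at h2

/-- The map `M ⊗ H → M ⊗ H ⊗ H`, `m ⊗ h ↦ m₀ ⊗ S⁻¹(h₁) m₁ ⊗ h₂`. -/
noncomputable def coactAntipodeInvComul : M ⊗[k] H →ₗ[k] (M ⊗[k] H) ⊗[k] H :=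
  (coactAntipodeInv k H M).rTensor H ∘ₗ (TensorProduct.assoc k M H H).symm.toLinearMap ∘ₗ
    (Coalgebra.comul : H →ₗ[k] H ⊗[k] H).lTensor M

theorem coactAntipodeInvComul_comp_coact : coactAntipodeInvComul k H M ∘ₗ coact k H M =
    ((TensorProduct.mk k M H).flip 1).rTensor H ∘ₗ coact k H M := by
  rw [← coactAntipodeInv_comp_coact, LinearMap.rTensor_comp, coactAntipodeInvComul,
    LinearMap.comp_assoc, LinearMap.comp_assoc, ← RightComodule.coassoc]
  ext m
  simp

end Comodule

variable {A : Type*} [Ring A] [Algebra k A] [RightComodule k H A]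
  {M : Type*} [AddCommGroup M] [Module k M] [Module A M] [IsScalarTower k A M]
  [RightComodule k H M] [IsHopfModule k H A M]

theorem coactAntipodeInvComul_diagAct (z : A ⊗[k] H) (m : M) :
    coactAntipodeInvComul k H M (diagAct k H A M z (m ⊗ₜ 1)) =
      ((diagAct k H A M).flip (coact k H M m)).rTensor H (coactAntipodeInvComul k H A z) := by
  induction z using TensorProduct.induction_on with
  | zero => simp
  | add y z hy hz => simp only [map_add, LinearMap.add_apply, hy, hz]
  | tmul a h =>
    simp only [diagAct_tmul, mul_one, coactAntipodeInvComul, LinearMap.comp_apply,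
      LinearMap.lTensor_tmul]
    induction (Coalgebra.comul : H →ₗ[k] H ⊗[k] H) h using TensorProduct.induction_on with
    | zero => simp
    | add y z hy hz => simp only [TensorProduct.tmul_add, map_add, hy, hz]
    | tmul g g' =>
      simp only [LinearEquiv.coe_coe, TensorProduct.assoc_symm_tmul, LinearMap.rTensor_tmul,
        LinearMap.flip_apply]
      congr 1
      simp only [coactAntipodeInv, TensorProduct.lift.tmul, LinearMap.comp_apply,
        LinearMap.flip_apply, IsHopfModule.coact_smul]
      generalize antipodeInv k H g = s
      induction coact k H A a using TensorProduct.induction_on with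
      | zero => simp
      | add y z hy hz => simp only [map_add, LinearMap.add_apply, hy, hz]
      | tmul b h' =>
        induction coact k H M m using TensorProduct.induction_on with
        | zero => simp
        | add y z hy hz => simp only [map_add, hy, hz]
        | tmul n g'' => simp [diagAct_tmul, rightFactorAct_tmul, mul_assoc]

end Coinvariants

section Generation

variable {k : Type v} {H A M : Type u} [CommRing k] [Ring H] [HopfAlgebra k H]
  [BijectiveAntipode k H] [Ring A] [Algebra k A] [RightComodule k H A] [IsComoduleAlgebra k H A]
  [AddCommGroup M] [Module k M] [Module A M] [IsScalarTower k A M]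
  [RightComodule k H M] [IsHopfModule k H A M]

variable (k H A M) in
/-- The coaction of a relative Hopf module is linear over the coinvariants. -/
noncomputable def coactLinear : M →ₗ[coinvariants k H A] M ⊗[k] H where
  toFun := coact k H M
  map_add' := map_add _
  map_smul' r m := by
    rw [Subalgebra.smul_def, IsHopfModule.coact_smul, coact_coinvariant]
    induction coact k H M m using TensorProduct.induction_on with
    | zero => simp
    | add y z hy hz => simp only [map_add, smul_add, hy, hz]
    | tmul n g => rw [diagAct_tmul, one_mul]; rfl

variable (k H A M) in
/-- The map `m ↦ m ⊗ 1`. -/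
noncomputable def tmulOneLinear : M →ₗ[coinvariants k H A] M ⊗[k] H where
  toFun m := m ⊗ₜ 1
  map_add' _ _ := TensorProduct.add_tmul _ _ _
  map_smul' _ _ := rfl

/-- If `A` is a Hopf-Galois extension of its coinvariants and flat over them, then every relative
Hopf module is generated by its coinvariants. -/
theorem span_coinvariants_eq_top (hA : IsRightFaithfullyFlatGalois k H A) :
    Submodule.span A {n : M | coact k H M n = n ⊗ₜ 1} = ⊤ := by
  obtain ⟨hcan, hflat, -⟩ := hA
  rw [eq_top_iff]
  rintro μ -
  obtain ⟨x, hx⟩ := canModule_surjective M hcan (coact k H M μ)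
  have hact : ∀ (z : A ⊗[k] H) (y : M ⊗[k] H),
      diagAct k H A (M ⊗[k] H) z (y ⊗ₜ 1) =
      ((diagAct k H A M).flip y).rTensor H (((TensorProduct.mk k A H).flip 1).rTensor H z) := by
    intro z y
    induction z using TensorProduct.induction_on with
    | zero => simp
    | add z w hz hw => simp only [map_add, LinearMap.add_apply, hz, hw]
    | tmul a h =>
      simp only [diagAct_tmul, mul_one, LinearMap.rTensor_tmul, LinearMap.flip_apply,
        TensorProduct.mk_apply]
      congr 1
      induction y using TensorProduct.induction_on with
      | zero => simp
      | add z w hz hw => simp only [map_add, smul_add, hz, hw]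
      | tmul m g => rw [diagAct_tmul, one_mul]; rfl
  have h1 : ∀ x, canModule k H A (M ⊗[k] H) (BalancedTensor.map k _ A (coactLinear k H A M) x) =
      coactAntipodeInvComul k H M (canModule k H A M x) := by
    intro x
    induction x using BalancedTensor.induction_on with
    | zero => simp
    | add y z hy hz => simp only [map_add, hy, hz]
    | tmul a m =>
      rw [map_tmul, canModule_tmul, canModule_tmul, coactAntipodeInvComul_diagAct, hact]
      congr 1
      exact (LinearMap.congr_fun (coactAntipodeInvComul_comp_coact k H A) a).symm
  have h2 : ∀ x, canModule k H A (M ⊗[k] H) (BalancedTensor.map k _ A (tmulOneLinear k H A M) x) =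
      ((TensorProduct.mk k M H).flip 1).rTensor H (canModule k H A M x) := by
    intro x
    induction x using BalancedTensor.induction_on with
    | zero => simp
    | add y z hy hz => simp only [map_add, hy, hz]
    | tmul a m =>
      rw [map_tmul, canModule_tmul, canModule_tmul]
      induction coact k H A a using TensorProduct.induction_on with
      | zero => simp
      | add y z hy hz => simp only [map_add, LinearMap.add_apply, hy, hz]
      | tmul b h => simp [tmulOneLinear, diagAct_tmul]; rfl
  have h3 : BalancedTensor.map k _ A (coactLinear k H A M) x =
      BalancedTensor.map k _ A (tmulOneLinear k H A M) x := by
    apply canModule_injective _ hcan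
    rw [h1, h2, hx]
    exact LinearMap.congr_fun (coactAntipodeInvComul_comp_coact k H M) μ
  set d := coactLinear k H A M - tmulOneLinear k H A M with hd
  set L := Submodule.span A {n : M | coact k H M n = n ⊗ₜ 1} with hL
  have hker : ∀ n ∈ LinearMap.ker d, n ∈ L := fun n hn =>
    Submodule.subset_span (sub_eq_zero.1 hn)
  have hinj : Function.Injective ((LinearMap.ker d).liftQ d le_rfl) := by
    rw [← LinearMap.ker_eq_bot]
    exact Submodule.ker_liftQ_eq_bot _ _ _ le_rfl
  have h4 : BalancedTensor.map k _ A (LinearMap.ker d).mkQ x = 0 := by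
    apply hflat _ _ _ hinj
    rw [map_zero, ← LinearMap.comp_apply, ← map_comp, Submodule.liftQ_mkQ]
    have : BalancedTensor.map k (coinvariants k H A) A d =
        BalancedTensor.map k _ A (coactLinear k H A M) -
          BalancedTensor.map k _ A (tmulOneLinear k H A M) :=
      hom_ext fun a m => by
        rw [LinearMap.sub_apply, map_tmul, map_tmul, map_tmul, hd, LinearMap.sub_apply]
        exact map_sub (BalancedTensor.mk k _ A (M ⊗[k] H) a) _ _
    rw [this, LinearMap.sub_apply, h3, sub_self]
  set π : (M ⧸ LinearMap.ker d) →ₗ[coinvariants k H A] M ⧸ L :=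
    (LinearMap.ker d).liftQ (L.mkQ.restrictScalars _) (fun n hn => by
      simpa using hker n hn) with hπ
  have h5 : ∀ x, balancedSmul k H A (M ⧸ L) (BalancedTensor.map k _ A π
      (BalancedTensor.map k _ A (LinearMap.ker d).mkQ x)) =
      L.mkQ (balancedSmul k H A M x) := by
    intro x
    induction x using BalancedTensor.induction_on with
    | zero => simp
    | add y z hy hz => simp only [map_add, hy, hz]
    | tmul a m => simp [map_tmul, balancedSmul_tmul, hπ]
  have h6 := h5 x
  rw [h4, map_zero, map_zero, ← rid_counit_canModule, hx, rid_counit_coact] at h6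
  exact (Submodule.Quotient.mk_eq_zero L).1 h6.symm

end Generation

end HopfGalois

namespace HopfGalois

open BalancedTensor

/-! ### Coactions on modules of homomorphisms -/

section HomCoaction

variable {k H : Type*} [CommRing k] [Ring H] [HopfAlgebra k H]
  {M L X : Type*} [AddCommGroup M] [Module k M] [RightComodule k H M]
  [AddCommGroup L] [Module k L] [AddCommGroup X] [Module k X]

/-- For a `k`-module `X` of maps from `M` to `L`, the map `X ⊗ W → Hom(M, L ⊗ W)` sending
`f ⊗ w` to `m ↦ f m ⊗ w`. -/
noncomputable def homNu (W : Type*) [AddCommGroup W] [Module k W] {M L : Type*} [AddCommGroup M]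
    [Module k M] [AddCommGroup L] [Module k L] (e : X →ₗ[k] M →ₗ[k] L) :
    X ⊗[k] W →ₗ[k] M →ₗ[k] L ⊗[k] W :=
  TensorProduct.rTensorHomToHomRTensor (RingHom.id k) M L W ∘ₗ e.rTensor W

theorem homNu_tmul {W M L : Type*} [AddCommGroup W] [Module k W] [AddCommGroup M]
    [Module k M] [AddCommGroup L] [Module k L] (e : X →ₗ[k] M →ₗ[k] L) (x : X) (w : W) (m : M) :
    homNu W e (x ⊗ₜ w) m = e x m ⊗ₜ w := by
  simp [homNu]

theorem homNu_injective {W M L : Type*} [AddCommGroup W] [Module k W] [Module.Projective k W]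
    [AddCommGroup M] [Module k M] [AddCommGroup L] [Module k L] (e : X →ₗ[k] M →ₗ[k] L)
    (he : Function.Injective e) : Function.Injective (homNu W e) := by
  classical
  rw [injective_iff_map_eq_zero]
  intro t ht
  obtain ⟨s, hs⟩ := Module.projective_def'.1 (inferInstance : Module.Projective k W)
  have comp : ∀ w : W, (TensorProduct.rid k X) ((Finsupp.lapply w ∘ₗ s).lTensor X t) = 0 := by
    intro w
    apply he
    rw [map_zero]
    ext m
    have h1 : ∀ t : X ⊗[k] W, e ((TensorProduct.rid k X) ((Finsupp.lapply w ∘ₗ s).lTensor X t)) m =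
        (TensorProduct.rid k L) ((Finsupp.lapply w ∘ₗ s).lTensor L (homNu W e t m)) := by
      intro t
      induction t using TensorProduct.induction_on with
      | zero => simp
      | add x y hx hy => simp only [map_add, LinearMap.add_apply, hx, hy]
      | tmul x y => simp [homNu_tmul]
    rw [h1, ht]
    simp
  have h2 : (TensorProduct.finsuppScalarRight k k X W) (s.lTensor X t) = 0 := by
    ext w
    rw [Finsupp.zero_apply, ← comp w]
    generalize t = t'
    induction t' using TensorProduct.induction_on with
    | zero => simp
    | add x y hx hy => simp only [map_add, Finsupp.add_apply, hx, hy]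
    | tmul x y => simp
  have h3 : s.lTensor X t = 0 := by simpa using h2
  have h4 : (Finsupp.linearCombination k id ∘ₗ s).lTensor X t = 0 := by
    rw [LinearMap.lTensor_comp, LinearMap.comp_apply, h3, map_zero]
  rwa [hs, LinearMap.lTensor_id] at h4

theorem twist_sndMulAct_twist_fstMulAct (G : M →ₗ[k] L ⊗[k] (H ⊗[k] H)) :
    twist k H (sndMulAct k H L).toLinearMap (twist k H (fstMulAct k H L).toLinearMap G) =
      twist k H (diagMulAct k H L).toLinearMap G := by
  apply twist_twist
  intro h v
  induction v using TensorProduct.induction_on with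
  | zero => simp
  | add x y hx hy => simp only [map_add, Finset.sum_add_distrib, hx, hy]
  | tmul m w =>
    have he := (Coalgebra.Repr.arbitrary k h).eq
    simp only [AlgHom.toLinearMap_apply, rightFactorAct_tmul, AlgHom.comp_apply,
      Bialgebra.comulAlgHom_apply, ← he, map_sum, LinearMap.sum_apply, TensorProduct.tmul_sum]
    refine Finset.sum_congr rfl fun i _ => ?_
    simp [← mul_assoc]

theorem comul_twist_homNu (e : X →ₗ[k] M →ₗ[k] L) (t : X ⊗[k] H) :
    (Coalgebra.comul : H →ₗ[k] H ⊗[k] H).lTensor L ∘ₗ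
        twist k H (mulAct k H L).toLinearMap (homNu H e t) =
      twist k H (diagMulAct k H L).toLinearMap
        (homNu (H ⊗[k] H) e ((Coalgebra.comul : H →ₗ[k] H ⊗[k] H).lTensor X t)) := by
  apply comp_twist
  intro g m
  induction t using TensorProduct.induction_on with
  | zero => simp
  | add x y hx hy => simp only [map_add, LinearMap.add_apply, hx, hy]
  | tmul x h => simp [homNu_tmul, rightFactorAct_tmul]

theorem assoc_homNu_twist (e : X →ₗ[k] M →ₗ[k] L) (s : X ⊗[k] H) (g : H) (m : M) :
    TensorProduct.assoc k L H H (twist k H (mulAct k H L).toLinearMap (homNu H e s) m ⊗ₜ g) =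
      twist k H (fstMulAct k H L).toLinearMap
        (homNu (H ⊗[k] H) e (TensorProduct.assoc k X H H (s ⊗ₜ g))) m := by
  have := comp_twist k H ((TensorProduct.assoc k L H H).toLinearMap ∘ₗ
      (TensorProduct.mk k (L ⊗[k] H) H).flip g) (mulAct k H L).toLinearMap
      (fstMulAct k H L).toLinearMap (homNu H e s)
      (homNu (H ⊗[k] H) e (TensorProduct.assoc k X H H (s ⊗ₜ g))) (by
    intro g' m
    induction s using TensorProduct.induction_on with
    | zero => simp
    | add x y hx hy =>
      simp only [map_add, LinearMap.add_apply, TensorProduct.add_tmul, hx, hy]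
    | tmul x h => simp [homNu_tmul, rightFactorAct_tmul])
  exact LinearMap.congr_fun this m

variable [RightComodule k H L]

theorem coactLeft_twist_mulAct (F : M →ₗ[k] L ⊗[k] H) :
    coactLeft k H L ∘ₗ twist k H (mulAct k H L).toLinearMap F =
      twist k H (sndMulAct k H L).toLinearMap (coactLeft k H L ∘ₗ F) := by
  apply comp_twist
  intro g m
  simp only [LinearMap.comp_apply]
  generalize F m = y
  induction y using TensorProduct.induction_on with
  | zero => simp
  | add x y hx hy => simp only [map_add, hx, hy]
  | tmul m h =>
    simp only [AlgHom.toLinearMap_apply, rightFactorAct_tmul, LinearMap.rTensor_tmul]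
    generalize coact k H L m = z
    induction z using TensorProduct.induction_on with
    | zero => simp
    | add x y hx hy => simp only [map_add, TensorProduct.add_tmul, hx, hy]
    | tmul m' h' => simp [rightFactorAct_tmul]

/-- For a module `X` of maps from `M` to `L`, the tensor `t = f₀ ⊗ f₁ : X ⊗ H` describes the
coaction of `f : X`: one has `ρ(f m) = f₀ (m₀) ⊗ m₁ f₁` for all `m`. -/
def HomDescribes (e : X →ₗ[k] M →ₗ[k] L) (f : X) (t : X ⊗[k] H) : Prop :=
  coact k H L ∘ₗ e f = twist k H (mulAct k H L).toLinearMap (homNu H e t)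

theorem Describes.homDescribes {X : Type*} [Ring X] [Algebra k X] {e : X →ₗ[k] M →ₗ[k] M} {f : X}
    {t : X ⊗[k] H} (h : Describes k H e f t) : HomDescribes e f t := h

theorem HomDescribes.add {e : X →ₗ[k] M →ₗ[k] L} {f g : X} {s t : X ⊗[k] H}
    (hs : HomDescribes e f s) (ht : HomDescribes e g t) : HomDescribes e (f + g) (s + t) := by
  unfold HomDescribes at *
  rw [map_add, map_add, twist_add, ← hs, ← ht, LinearMap.comp_add]

theorem HomDescribes.smul {e : X →ₗ[k] M →ₗ[k] L} {f : X} {t : X ⊗[k] H}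
    (ht : HomDescribes e f t) (c : k) : HomDescribes e (c • f) (c • t) := by
  unfold HomDescribes at *
  rw [map_smul, map_smul, twist_smul, ← ht, LinearMap.comp_smul]

theorem HomDescribes.precomp {B : Type*} [Ring B] [Algebra k B] [Module B X] [IsScalarTower k B X]
    {eB : B →ₗ[k] M →ₗ[k] M} {e : X →ₗ[k] M →ₗ[k] L} (he : ∀ b x, e (b • x) = e x ∘ₗ eB b)
    {b : B} {f : X} {s : B ⊗[k] H} {t : X ⊗[k] H}
    (hs : Describes k H eB b s) (ht : HomDescribes e f t) :
    HomDescribes e (b • f) (diagAct k H B X s t) := by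
  unfold Describes HomDescribes at *
  rw [he, ← LinearMap.comp_assoc, ht, twist, LinearMap.comp_assoc, hs]
  apply comp_twist
  intro h m
  clear hs ht
  induction s using TensorProduct.induction_on with
  | zero => simp
  | add x y hx hy =>
    simp only [map_add, LinearMap.add_apply, hx, hy]
  | tmul x g =>
    simp only [nu_tmul, AlgHom.toLinearMap_apply, rightFactorAct_tmul, TensorProduct.lift.tmul,
      LinearMap.comp_apply, LinearMap.flip_apply]
    induction t using TensorProduct.induction_on with
    | zero => simp
    | add y z hy hz =>
      simp only [map_add, LinearMap.add_apply, hy, hz]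
    | tmul y g' => simp [homNu_tmul, rightFactorAct_tmul, he, diagAct_tmul]

theorem HomDescribes.counit {e : X →ₗ[k] M →ₗ[k] L} (he : Function.Injective e) {f : X}
    {t : X ⊗[k] H} (ht : HomDescribes e f t) :
    TensorProduct.rid k X ((Coalgebra.counit : H →ₗ[k] k).lTensor X t) = f := by
  apply he
  have h0 := RightComodule.counit (k := k) (H := H) (M := L)
  have h1 : (TensorProduct.rid k L).toLinearMap ∘ₗ (Coalgebra.counit : H →ₗ[k] k).lTensor L ∘ₗ
      twist k H (mulAct k H L).toLinearMap (homNu H e t) =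
      twist k H (LinearMap.lsmul k L ∘ₗ Coalgebra.counit)
        (e (TensorProduct.rid k X ((Coalgebra.counit : H →ₗ[k] k).lTensor X t))) := by
    rw [← LinearMap.comp_assoc]
    apply comp_twist
    intro h m
    clear ht
    induction t using TensorProduct.induction_on with
    | zero => simp
    | add x y hx hy => simp only [map_add, LinearMap.add_apply, hx, hy]
    | tmul x g =>
      simp [homNu_tmul, rightFactorAct_tmul, mul_smul]
      exact smul_comm _ _ _
  rw [twist_counit k H (LinearMap.lsmul k L ∘ₗ Coalgebra.counit) _ (fun _ _ => rfl), ← ht] at h1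
  rw [← h1, ← LinearMap.comp_assoc, ← LinearMap.comp_assoc,
    LinearMap.comp_assoc _ _ (TensorProduct.rid k L).toLinearMap, h0, LinearMap.id_comp]

theorem coactLeft_homNu {e : X →ₗ[k] M →ₗ[k] L} (δ : X →ₗ[k] X ⊗[k] H)
    (hδ : ∀ f, HomDescribes e f (δ f)) (s : X ⊗[k] H) :
    coactLeft k H L ∘ₗ homNu H e s = twist k H (fstMulAct k H L).toLinearMap
      (homNu (H ⊗[k] H) e (TensorProduct.assoc k X H H (δ.rTensor H s))) := by
  induction s using TensorProduct.induction_on with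
  | zero => simp [twist_zero]
  | add x y hx hy => simp only [map_add, LinearMap.comp_add, twist_add, hx, hy]
  | tmul x g =>
    ext m
    rw [LinearMap.rTensor_tmul, ← assoc_homNu_twist, ← hδ]
    simp [homNu_tmul]

/-- The tensor `f₀ ⊗ f₁ = f ⊗ 1` describes the coaction of `f` if and only if `f` is colinear. -/
theorem homDescribes_tmul_one_iff {e : X →ₗ[k] M →ₗ[k] L} {f : X} :
    HomDescribes e f (f ⊗ₜ (1 : H)) ↔ IsColinear k H (e f) := by
  have : twist k H (mulAct k H L).toLinearMap (homNu H e (f ⊗ₜ (1 : H))) =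
      (e f).rTensor H ∘ₗ coact k H M := by
    rw [twist]
    congr 1
    ext m h
    simp [homNu_tmul, rightFactorAct_tmul]
  rw [HomDescribes, this, IsColinear]

variable [BijectiveAntipode k H] [Module.Projective k H]

theorem HomDescribes.unique {e : X →ₗ[k] M →ₗ[k] L} (he : Function.Injective e) {f : X}
    {s t : X ⊗[k] H} (hs : HomDescribes e f s) (ht : HomDescribes e f t) : s = t :=
  homNu_injective e he (twist_injective k H (mulAct k H L) (hs.symm.trans ht))

theorem coassoc_of_homDescribes {e : X →ₗ[k] M →ₗ[k] L} (he : Function.Injective e)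
    (δ : X →ₗ[k] X ⊗[k] H) (hδ : ∀ f, HomDescribes e f (δ f)) :
    (TensorProduct.assoc k X H H).toLinearMap ∘ₗ δ.rTensor H ∘ₗ δ =
      (Coalgebra.comul : H →ₗ[k] H ⊗[k] H).lTensor X ∘ₗ δ := by
  ext1 f
  apply homNu_injective e he
  apply twist_injective k H (diagMulAct k H L)
  simp only [LinearMap.comp_apply, LinearEquiv.coe_coe]
  rw [← comul_twist_homNu, ← twist_sndMulAct_twist_fstMulAct, ← coactLeft_homNu δ hδ,
    ← coactLeft_twist_mulAct, ← hδ, ← LinearMap.comp_assoc, ← LinearMap.comp_assoc,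
    ← RightComodule.coassoc]
  rfl

end HomCoaction

/-! ### The dual of a relative Hopf module -/

/-- The dual `Hom_A(M, A)` of a left `A`-module, as a left module over `End_A(M)ᵒᵖ`. -/
def HomDual (A M : Type*) [Ring A] [AddCommGroup M] [Module A M] : Type _ := M →ₗ[A] A

namespace HomDual

variable (k H A M : Type*) [CommRing k] [Ring H] [HopfAlgebra k H] [Ring A] [Algebra k A]
  [AddCommGroup M] [Module k M] [Module A M]

instance : AddCommGroup (HomDual A M) := inferInstanceAs (AddCommGroup (M →ₗ[A] A))

noncomputable instance : Module k (HomDual A M) := inferInstanceAs (Module k (M →ₗ[A] A))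

instance : FunLike (HomDual A M) M A := inferInstanceAs (FunLike (M →ₗ[A] A) M A)

instance : LinearMapClass (HomDual A M) A M A :=
  inferInstanceAs (LinearMapClass (M →ₗ[A] A) A M A)

variable {A M} in
@[ext]
theorem ext {f g : HomDual A M} (h : ∀ m, f m = g m) : f = g := LinearMap.ext h

instance : Module (Module.End A M)ᵐᵒᵖ (HomDual A M) where
  smul b f := LinearMap.comp (f : M →ₗ[A] A) b.unop
  one_smul _ := rfl
  mul_smul _ _ _ := rfl
  smul_zero _ := rfl
  smul_add _ _ _ := rfl
  add_smul _ _ _ := LinearMap.comp_add _ _ _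
  zero_smul _ := LinearMap.comp_zero _

variable [IsScalarTower k A M]

instance : IsScalarTower k (Module.End A M)ᵐᵒᵖ (HomDual A M) where
  smul_assoc c b f := by
    ext m
    exact (LinearMap.map_smul_of_tower f c (b.unop m))

/-- The elements of the dual as `k`-linear maps. -/
def toHom : HomDual A M →ₗ[k] M →ₗ[k] A where
  toFun f := LinearMap.restrictScalars k (f : M →ₗ[A] A)
  map_add' _ _ := rfl
  map_smul' _ _ := rfl

theorem toHom_injective : Function.Injective (toHom k A M) := by
  intro f g h
  ext m
  exact LinearMap.congr_fun h m

variable {A M}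

end HomDual

/-- A finitely generated projective module has a finite dual basis. -/
theorem IsSummandOfPower.exists_dual_basis {A M : Type*} [Ring A] [AddCommGroup M] [Module A M]
    (h : IsSummandOfPower A M A) : ∃ (n : ℕ) (F : Fin n → M →ₗ[A] A) (y : Fin n → M),
      ∀ m, ∑ j, F j m • y j = m := by
  obtain ⟨n, i, p, hpi⟩ := h
  refine ⟨n, fun j => LinearMap.proj j ∘ₗ i, fun j => p (Pi.single j 1), fun m => ?_⟩
  conv_rhs => rw [← LinearMap.id_apply (R := A) m, ← hpi, LinearMap.comp_apply]
  rw [LinearMap.pi_apply_eq_sum_univ p (i m)]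
  refine Finset.sum_congr rfl fun j _ => ?_
  simp only [LinearMap.comp_apply, LinearMap.proj_apply]
  congr 2
  ext l
  simp [Pi.single_apply, eq_comm]

section DualCoaction

variable {k H A M : Type*} [CommRing k] [Ring H] [HopfAlgebra k H] [BijectiveAntipode k H]
  [Ring A] [Algebra k A] [RightComodule k H A]
  [AddCommGroup M] [Module k M] [Module A M] [IsScalarTower k A M] [RightComodule k H M]

variable (k) in
theorem antipodeInv_mul (g h : H) :
    antipodeInv k H (g * h) = antipodeInv k H h * antipodeInv k H g := by
  apply (BijectiveAntipode.bijective (k := k) (H := H)).1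
  rw [HopfAlgebra.antipode_mul_antidistrib, antipode_antipodeInv, antipode_antipodeInv,
    antipode_antipodeInv]

/-- For an `A`-linear map `f : M → A` the map `m ↦ f(m₀)₀ ⊗ S⁻¹(m₁) f(m₀)₁` is `A`-linear. -/
theorem twist_antipodeInv_smul [IsComoduleAlgebra k H A] [IsHopfModule k H A M]
    (f : M →ₗ[A] A) (a : A) (m : M) :
    twist k H ((mulAct k H A).toLinearMap ∘ₗ antipodeInv k H)
      (coact k H A ∘ₗ f.restrictScalars k) (a • m) =
    a • twist k H ((mulAct k H A).toLinearMap ∘ₗ antipodeInv k H)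
      (coact k H A ∘ₗ f.restrictScalars k) m := by
  set τ := TensorProduct.lift (((mulAct k H A).toLinearMap ∘ₗ antipodeInv k H).flip ∘ₗ
    (coact k H A ∘ₗ f.restrictScalars k)) with hτ
  change τ (coact k H M (a • m)) = a • τ (coact k H M m)
  have h1 : ∀ (z : A ⊗[k] H) (n : M) (h : H), τ (diagAct k H A M z (n ⊗ₜ h)) =
      mulAct k H A (antipodeInv k H h)
        (diagAct k H A A (coactAntipodeInv k H A z) (coact k H A (f n))) := by
    intro z n h
    induction z using TensorProduct.induction_on with
    | zero => simp
    | add y z hy hz => simp only [map_add, LinearMap.add_apply, hy, hz]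
    | tmul b g =>
      simp only [diagAct_tmul, hτ, TensorProduct.lift.tmul, LinearMap.comp_apply,
        LinearMap.flip_apply, AlgHom.toLinearMap_apply, antipodeInv_mul, map_mul,
        Module.End.mul_apply, LinearMap.coe_restrictScalars, map_smul, IsHopfModule.coact_smul,
        coactAntipodeInv]
      congr 1
      generalize antipodeInv k H g = s
      induction coact k H A b using TensorProduct.induction_on with
      | zero => simp
      | add y z hy hz => simp only [map_add, LinearMap.add_apply, hy, hz]
      | tmul b h' =>
        induction coact k H A (f n) using TensorProduct.induction_on with
        | zero => simp
        | add y z hy hz => simp only [map_add, hy, hz]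
        | tmul n g'' => simp [diagAct_tmul, rightFactorAct_tmul, mul_assoc]
  rw [IsHopfModule.coact_smul]
  induction coact k H M m using TensorProduct.induction_on with
  | zero => simp
  | add y z hy hz => simp only [map_add, smul_add, hy, hz]
  | tmul n h =>
    rw [h1]
    have := LinearMap.congr_fun (coactAntipodeInv_comp_coact k H A) a
    simp only [LinearMap.comp_apply, LinearMap.flip_apply, TensorProduct.mk_apply] at this
    rw [this, hτ]
    simp only [TensorProduct.lift.tmul, LinearMap.comp_apply, LinearMap.flip_apply,
      AlgHom.toLinearMap_apply, LinearMap.coe_restrictScalars]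
    generalize antipodeInv k H h = s
    induction coact k H A (f n) using TensorProduct.induction_on with
    | zero => simp
    | add y z hy hz => simp only [map_add, smul_add, hy, hz]
    | tmul n g'' => simp [diagAct_tmul, rightFactorAct_tmul, TensorProduct.smul_tmul']

variable [IsComoduleAlgebra k H A] [IsHopfModule k H A M]

theorem HomDual.exists_homDescribes (hM : IsSummandOfPower A M A) (f : HomDual A M) :
    ∃ t : HomDual A M ⊗[k] H, HomDescribes (HomDual.toHom k A M) f t := by
  obtain ⟨n, F, y, hF⟩ := hM.exists_dual_basis
  set G := twist k H ((mulAct k H A).toLinearMap ∘ₗ antipodeInv k H)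
      (coact k H A ∘ₗ HomDual.toHom k A M f) with hG
  have hlin : ∀ (a : A) (m : M), G (a • m) = a • G m := twist_antipodeInv_smul f
  let r : Fin n → A →ₗ[k] HomDual A M := fun j =>
    { toFun := fun a => (LinearMap.toSpanSingleton A A a ∘ₗ F j : M →ₗ[A] A)
      map_add' := fun a b => HomDual.ext fun m => mul_add (F j m) a b
      map_smul' := fun c a => HomDual.ext fun m => mul_smul_comm c (F j m) a }
  have hr : ∀ j (z : A ⊗[k] H) (m : M),
      homNu H (HomDual.toHom k A M) ((r j).rTensor H z) m = F j m • z := by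
    intro j z m
    induction z using TensorProduct.induction_on with
    | zero => simp
    | add y z hy hz => simp only [map_add, LinearMap.add_apply, smul_add, hy, hz]
    | tmul a h => rw [LinearMap.rTensor_tmul, homNu_tmul]; rfl
  refine ⟨∑ j, (r j).rTensor H (G (y j)), ?_⟩
  have : homNu H (HomDual.toHom k A M) (∑ j, (r j).rTensor H (G (y j))) = G := by
    ext1 m
    rw [map_sum, LinearMap.sum_apply]
    conv_rhs => rw [← hF m, map_sum]
    exact Finset.sum_congr rfl fun j _ => by rw [hr, hlin]
  rw [HomDescribes, this, hG, twist_twist_antipodeInv]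

variable [Module.Projective k H]

/-- The coaction `f ↦ f₀ ⊗ f₁` on `Hom_A(M, A)` with `ρ(f m) = f₀ (m₀) ⊗ m₁ f₁`, for a relative
Hopf module `M` that is finitely generated and projective over `A`. -/
noncomputable def HomDual.coaction (hM : IsSummandOfPower A M A) :
    HomDual A M →ₗ[k] HomDual A M ⊗[k] H where
  toFun f := (HomDual.exists_homDescribes hM f).choose
  map_add' f g := (HomDual.exists_homDescribes hM (f + g)).choose_spec.unique
    (HomDual.toHom_injective k A M)
    ((HomDual.exists_homDescribes hM f).choose_spec.add
      (HomDual.exists_homDescribes hM g).choose_spec)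
  map_smul' r f := (HomDual.exists_homDescribes hM (r • f)).choose_spec.unique
    (HomDual.toHom_injective k A M) ((HomDual.exists_homDescribes hM f).choose_spec.smul r)

theorem HomDual.homDescribes_coaction (hM : IsSummandOfPower A M A) (f : HomDual A M) :
    HomDescribes (HomDual.toHom k A M) f (HomDual.coaction (k := k) (H := H) hM f) :=
  (HomDual.exists_homDescribes hM f).choose_spec

/-- `Hom_A(M, A)` is a right comodule. -/
@[reducible]
noncomputable def HomDual.rightComodule (hM : IsSummandOfPower A M A) :
    RightComodule k H (HomDual A M) where
  coact := HomDual.coaction hM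
  coassoc := coassoc_of_homDescribes (HomDual.toHom_injective k A M) _
    (HomDual.homDescribes_coaction hM)
  counit := by
    ext1 f
    exact (HomDual.homDescribes_coaction hM f).counit (HomDual.toHom_injective k A M)

/-- `Hom_A(M, A)` is a relative Hopf module over `END_A(M)ᵒᵖ`. -/
theorem HomDual.isHopfModule (hM : IsSummandOfPower A M A) :
    letI := HomDual.rightComodule (k := k) (H := H) hM
    IsHopfModule k H (rationalEndOp k H A M) (HomDual A M) :=
  letI := HomDual.rightComodule (k := k) (H := H) hM
  { coact_smul := fun b f => (HomDual.homDescribes_coaction hM (b • f)).unique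
      (HomDual.toHom_injective k A M)
      (HomDescribes.precomp (eB := rationalEndOpToHom k H A M) (fun _ _ => rfl)
        (describes_rationalEndOpCoact k H b) (HomDual.homDescribes_coaction hM f)) }

theorem HomDual.isColinear_of_coinvariant (hM : IsSummandOfPower A M A) (f : HomDual A M)
    (hf : HomDual.coaction (k := k) (H := H) hM f = f ⊗ₜ 1) :
    IsColinear k H (HomDual.toHom k A M f) := by
  have := HomDual.homDescribes_coaction (k := k) (H := H) hM f
  rw [hf] at this
  exact homDescribes_tmul_one_iff.1 this

end DualCoaction

end HopfGalois

namespace HopfGalois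

open BalancedTensor

/-! ### Colinear maps and summands of powers -/

section Colinear

variable {k H : Type*} [CommRing k] [Ring H] [HopfAlgebra k H]
  {M L N : Type*} [AddCommGroup M] [Module k M] [RightComodule k H M]
  [AddCommGroup L] [Module k L] [RightComodule k H L]
  [AddCommGroup N] [Module k N] [RightComodule k H N]

theorem IsColinear.apply {f : M →ₗ[k] L} (hf : IsColinear k H f) (m : M) :
    coact k H L (f m) = f.rTensor H (coact k H M m) :=
  LinearMap.congr_fun hf m

theorem IsColinear.coact_coinvariant {f : M →ₗ[k] L} (hf : IsColinear k H f) {m : M}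
    (hm : coact k H M m = m ⊗ₜ 1) : coact k H L (f m) = f m ⊗ₜ 1 := by
  rw [hf.apply, hm, LinearMap.rTensor_tmul]

theorem IsColinear.comp {g : L →ₗ[k] N} {f : M →ₗ[k] L} (hg : IsColinear k H g)
    (hf : IsColinear k H f) : IsColinear k H (g ∘ₗ f) := by
  unfold IsColinear at *
  rw [← LinearMap.comp_assoc, hg, LinearMap.comp_assoc, hf, LinearMap.rTensor_comp,
    LinearMap.comp_assoc]

theorem IsColinear.sum {ι : Type*} (s : Finset ι) {f : ι → M →ₗ[k] L}
    (hf : ∀ i ∈ s, IsColinear k H (f i)) : IsColinear k H (∑ i ∈ s, f i) := by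
  ext1 m
  simp only [LinearMap.comp_apply, LinearMap.sum_apply, map_sum]
  have : ∀ z : M ⊗[k] H, (∑ i ∈ s, f i).rTensor H z = ∑ i ∈ s, (f i).rTensor H z := by
    intro z
    induction z using TensorProduct.induction_on with
    | zero => simp
    | add y z hy hz => simp only [map_add, hy, hz, Finset.sum_add_distrib]
    | tmul m h => simp [TensorProduct.sum_tmul]
  rw [this]
  exact Finset.sum_congr rfl fun i hi => (hf i hi).apply m

theorem isColinear_single (n : ℕ) (j : Fin n) :
    IsColinear k H (LinearMap.single k (fun _ : Fin n => M) j) :=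
  piCoact_comp_single k H M n j

theorem isColinear_proj (n : ℕ) (j : Fin n) :
    IsColinear k H (LinearMap.proj j : (Fin n → M) →ₗ[k] M) := by
  refine LinearMap.pi_ext' fun l => ?_
  change _ = (LinearMap.proj j).rTensor H ∘ₗ (piCoact k H M n ∘ₗ _)
  rw [piCoact_comp_single, ← LinearMap.comp_assoc, ← LinearMap.rTensor_comp, LinearMap.comp_assoc]
  by_cases h : j = l
  · subst h
    simp [LinearMap.proj_comp_single_same]
  · rw [LinearMap.proj_comp_single_ne k _ j l h]
    simp

theorem isColinear_pi {n : ℕ} {f : Fin n → M →ₗ[k] L} (hf : ∀ j, IsColinear k H (f j)) :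
    IsColinear k H (LinearMap.pi f) := by
  have : LinearMap.pi f = ∑ j, LinearMap.single k (fun _ : Fin n => L) j ∘ₗ f j := by
    ext m l
    simp [Pi.single_apply]
  rw [this]
  exact IsColinear.sum _ fun j _ => (isColinear_single n j).comp (hf j)

variable {A : Type*} [Ring A] [Algebra k A] [RightComodule k H A]
  [Module A M] [IsScalarTower k A M] [IsHopfModule k H A M]

theorem isColinear_toSpanSingleton {y : M} (hy : coact k H M y = y ⊗ₜ 1) :
    IsColinear k H ((LinearMap.toSpanSingleton A M y).restrictScalars k) := by
  ext1 a
  simp only [LinearMap.comp_apply, LinearMap.coe_restrictScalars,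
    LinearMap.toSpanSingleton_apply, IsHopfModule.coact_smul, hy]
  induction coact k H A a using TensorProduct.induction_on with
  | zero => simp
  | add y z hy hz => simp only [map_add, LinearMap.add_apply, hy, hz]
  | tmul b h => simp [diagAct_tmul]

variable [IsComoduleAlgebra k H A]

/-- A relative Hopf module is a summand of a power of `A` if and only if it has a finite dual
basis of coinvariant elements and colinear maps. -/
theorem isHopfSummandOfPower_self_iff : IsHopfSummandOfPower k H A M A ↔
    ∃ (n : ℕ) (q : Fin n → M →ₗ[A] A) (y : Fin n → M),
      (∀ j, IsColinear k H ((q j).restrictScalars k)) ∧ (∀ j, coact k H M (y j) = y j ⊗ₜ 1) ∧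
      ∀ m, ∑ j, q j m • y j = m := by
  constructor
  · rintro ⟨n, i, p, hi, hp, hpi⟩
    refine ⟨n, fun j => LinearMap.proj j ∘ₗ i, fun j => p (Pi.single j 1),
      fun j => (isColinear_proj n j).comp hi, fun j => ?_, fun m => ?_⟩
    · exact hp.coact_coinvariant ((isColinear_single n j).coact_coinvariant
        IsComoduleAlgebra.coact_one)
    · conv_rhs => rw [← LinearMap.id_apply (R := A) m, ← hpi, LinearMap.comp_apply]
      rw [LinearMap.pi_apply_eq_sum_univ p (i m)]
      refine Finset.sum_congr rfl fun j _ => ?_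
      simp only [LinearMap.comp_apply, LinearMap.proj_apply]
      congr 2
      ext l
      simp [Pi.single_apply, eq_comm]
  · rintro ⟨n, q, y, hq, hy, hqy⟩
    refine ⟨n, LinearMap.pi q, ∑ j, LinearMap.toSpanSingleton A M (y j) ∘ₗ LinearMap.proj j,
      isColinear_pi hq, ?_, ?_⟩
    · have : (∑ j, LinearMap.toSpanSingleton A M (y j) ∘ₗ
          (LinearMap.proj j : (Fin n → A) →ₗ[A] A)).restrictScalars k =
          ∑ j, (LinearMap.toSpanSingleton A M (y j)).restrictScalars k ∘ₗ
            (LinearMap.proj j : (Fin n → A) →ₗ[k] A) := by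
        exact LinearMap.ext fun a => by simp
      rw [this]
      exact IsColinear.sum _ fun j _ =>
        (isColinear_toSpanSingleton (hy j)).comp (isColinear_proj n j)
    · ext m
      simp [hqy]

/-- `A` is a summand of a power of the relative Hopf module `M` if and only if `1` is a sum of
values of colinear maps at coinvariant elements. -/
theorem isHopfSummandOfPower_ring_iff : IsHopfSummandOfPower k H A A M ↔
    ∃ (n : ℕ) (p : Fin n → M →ₗ[A] A) (y : Fin n → M),
      (∀ j, IsColinear k H ((p j).restrictScalars k)) ∧ (∀ j, coact k H M (y j) = y j ⊗ₜ 1) ∧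
      ∑ j, p j (y j) = 1 := by
  constructor
  · rintro ⟨n, i, p, hi, hp, hpi⟩
    refine ⟨n, fun j => p ∘ₗ LinearMap.single A (fun _ => M) j, fun j => i 1 j,
      fun j => hp.comp (isColinear_single n j), fun j => ?_, ?_⟩
    · exact ((isColinear_proj n j).comp hi).coact_coinvariant IsComoduleAlgebra.coact_one
    · have := LinearMap.congr_fun hpi 1
      simp only [LinearMap.comp_apply, LinearMap.id_apply] at this
      conv_rhs => rw [← this]
      simp only [LinearMap.comp_apply, LinearMap.single_apply]
      rw [← map_sum, Finset.univ_sum_single]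
  · rintro ⟨n, p, y, hp, hy, hpy⟩
    refine ⟨n, LinearMap.pi fun j => LinearMap.toSpanSingleton A M (y j),
      ∑ j, p j ∘ₗ LinearMap.proj j, isColinear_pi fun j => isColinear_toSpanSingleton (hy j),
      ?_, ?_⟩
    · have : (∑ j, p j ∘ₗ (LinearMap.proj j : (Fin n → M) →ₗ[A] M)).restrictScalars k =
          ∑ j, (p j).restrictScalars k ∘ₗ (LinearMap.proj j : (Fin n → M) →ₗ[k] M) := by
        exact LinearMap.ext fun a => by simp
      rw [this]
      exact IsColinear.sum _ fun j _ => (hp j).comp (isColinear_proj n j)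
    · ext
      simp [hpy]

end Colinear

/-! ### Endomorphisms of a relative Hopf module -/

section Endomorphisms

variable {k H A M : Type*} [CommRing k] [Ring H] [HopfAlgebra k H] [BijectiveAntipode k H]
  [Ring A] [Algebra k A] [AddCommGroup M] [Module k M] [Module A M] [IsScalarTower k A M]
  [RightComodule k H M]

/-- The element of `END_A(M)ᵒᵖ` given by an endomorphism and a tensor describing its coaction. -/
def rationalEndOp.ofDescribes (f : Module.End A M) (t : (Module.End A M)ᵐᵒᵖ ⊗[k] H)
    (h : Describes k H (endOpToHom k A M) (MulOpposite.op f) t) : rationalEndOp k H A M :=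
  ⟨MulOpposite.op f, (isRational_unop_iff k H (MulOpposite.op f)).2 ⟨t, h⟩⟩

theorem rationalEndOp_ext {b c : rationalEndOp k H A M}
    (h : ∀ m, (b : (Module.End A M)ᵐᵒᵖ).unop m = (c : (Module.End A M)ᵐᵒᵖ).unop m) : b = c :=
  Subtype.ext (MulOpposite.unop_injective (LinearMap.ext h))

variable [Module.Projective k H]

theorem mem_coinvariants_rationalEndOp_iff (b : rationalEndOp k H A M) :
    b ∈ coinvariants k H (rationalEndOp k H A M) ↔
      IsColinear k H (rationalEndOpToHom k H A M b) := by
  rw [← homDescribes_tmul_one_iff]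
  have hb := (describes_rationalEndOpCoact k H b).homDescribes
  constructor
  · intro h
    have h' : rationalEndOpCoact k H A M b = b ⊗ₜ 1 := h
    rwa [h'] at hb
  · intro h
    exact hb.unique (rationalEndOpToHom_injective k H A M) h

/-- The coinvariant element of `END_A(M)ᵒᵖ` given by a colinear endomorphism. -/
def colinearEnd (f : Module.End A M) (hf : IsColinear k H (f.restrictScalars k)) :
    coinvariants k H (rationalEndOp k H A M) :=
  ⟨rationalEndOp.ofDescribes f (MulOpposite.op f ⊗ₜ 1) (homDescribes_tmul_one_iff.2 hf),
    (mem_coinvariants_rationalEndOp_iff _).2 hf⟩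

/-- The endomorphism of `M` underlying a coinvariant element of `END_A(M)ᵒᵖ`. -/
def coinvariantEnd (t : coinvariants k H (rationalEndOp k H A M)) : Module.End A M :=
  ((t : rationalEndOp k H A M) : (Module.End A M)ᵐᵒᵖ).unop

theorem isColinear_coinvariantEnd (t : coinvariants k H (rationalEndOp k H A M)) :
    IsColinear k H ((coinvariantEnd t).restrictScalars k) :=
  (mem_coinvariants_rationalEndOp_iff _).1 t.2

theorem coinvariantEnd_injective :
    Function.Injective (coinvariantEnd (k := k) (H := H) (A := A) (M := M)) := fun _ _ h =>
  Subtype.ext (Subtype.ext (MulOpposite.unop_injective h))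

end Endomorphisms

/-! ### Faithful flatness and left ideals of the coinvariants -/

section Ideals

variable {k : Type v} {H A : Type u} [CommRing k] [Ring H] [HopfAlgebra k H]
  [Ring A] [Algebra k A] [RightComodule k H A] [IsComoduleAlgebra k H A]

/-- If `A` is faithfully flat over its coinvariants `R`, then a left ideal of `R` that generates
the unit ideal of `A` is the unit ideal. -/
theorem eq_top_of_one_mem_span (hA : IsRightFaithfullyFlat k (coinvariants k H A) A)
    (I : Submodule (coinvariants k H A) (coinvariants k H A))
    (h : (1 : A) ∈ Submodule.span A ((fun r : coinvariants k H A => (r : A)) '' I)) : I = ⊤ := by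
  have h1 : ∀ x ∈ Submodule.span A ((fun r : coinvariants k H A => (r : A)) '' I), ∀ b : A,
      tmul k (coinvariants k H A) (b * x) (I.mkQ 1) = 0 := by
    intro x hx
    induction hx using Submodule.span_induction with
    | mem x hx =>
      obtain ⟨r, hr, rfl⟩ := hx
      intro b
      rw [← op_smul_eq (k := k), op_smul_tmul, ← map_smul, smul_eq_mul, mul_one,
        Submodule.mkQ_apply, (Submodule.Quotient.mk_eq_zero I).2 hr, BalancedTensor.tmul_zero]
    | zero => intro b; rw [mul_zero]; exact LinearMap.map_zero₂ (BalancedTensor.mk k _ _ _) _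
    | add x y _ _ hx hy => intro b; rw [mul_add, BalancedTensor.add_tmul, hx, hy, add_zero]
    | smul a x _ hx => intro b; rw [smul_eq_mul, ← mul_assoc, hx]
  have h2 : ∀ z : BalancedTensor k (coinvariants k H A) A (_ ⧸ I), z = 0 := by
    intro z
    induction z using BalancedTensor.induction_on with
    | zero => rfl
    | add x y hx hy => rw [hx, hy, add_zero]
    | tmul a q =>
      obtain ⟨r, rfl⟩ := Submodule.mkQ_surjective I q
      have : I.mkQ r = r • I.mkQ 1 := by rw [← map_smul, smul_eq_mul, mul_one]
      rw [this, ← op_smul_tmul, ← mul_one (MulOpposite.op r • a)]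
      exact h1 1 h _
  have := hA.2 (_ ⧸ I) ⟨fun x y => (h2 x).trans (h2 y).symm⟩
  exact Submodule.Quotient.subsingleton_iff.1 this

end Ideals

/-! ### Relative Hopf modules with a Galois endomorphism algebra are progenerators -/

section GaloisToProgenerator

variable {k : Type v} {H A M : Type u} [CommRing k]
  [Ring H] [HopfAlgebra k H] [BijectiveAntipode k H] [Module.Projective k H]
  [Ring A] [Algebra k A] [RightComodule k H A] [IsComoduleAlgebra k H A]
  [AddCommGroup M] [Module k M] [Module A M] [IsScalarTower k A M]
  [RightComodule k H M] [IsHopfModule k H A M]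

/-- If `END_A(M)ᵒᵖ` is faithfully flat Galois, then the dual of `M` is generated over it by the
colinear maps. -/
theorem HomDual.span_colinear_eq_top (hM : IsSummandOfPower A M A)
    (hB : IsRightFaithfullyFlatGalois k H (rationalEndOp k H A M)) :
    Submodule.span (rationalEndOp k H A M)
      {p : HomDual A M | IsColinear k H (HomDual.toHom k A M p)} = ⊤ := by
  let _ := HomDual.rightComodule (k := k) (H := H) hM
  have := HomDual.isHopfModule (k := k) (H := H) hM
  rw [eq_top_iff, ← span_coinvariants_eq_top (M := HomDual A M) hB]
  exact Submodule.span_mono fun p hp => HomDual.isColinear_of_coinvariant hM p hp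

theorem isHopfSummandOfPower_ring_of_galois (hA : IsRightFaithfullyFlatGalois k H A)
    (hM : IsProgenerator A M)
    (hB : IsRightFaithfullyFlatGalois k H (rationalEndOp k H A M)) :
    IsHopfSummandOfPower k H A A M := by
  set S : Set (coinvariants k H A) := {r | ∃ (p : HomDual A M) (n : M),
    IsColinear k H (HomDual.toHom k A M p) ∧ coact k H M n = n ⊗ₜ 1 ∧ p n = r} with hS
  have hspan : ∀ (f : HomDual A M) (m : M), f m ∈ Submodule.span A
      ((fun r : coinvariants k H A => (r : A)) '' Submodule.span (coinvariants k H A) S) := by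
    intro f
    have hf : f ∈ (⊤ : Submodule (rationalEndOp k H A M) (HomDual A M)) := trivial
    rw [← HomDual.span_colinear_eq_top hM.1 hB] at hf
    induction hf using Submodule.span_induction with
    | mem p hp =>
      intro m
      have hm : m ∈ (⊤ : Submodule A M) := trivial
      rw [← span_coinvariants_eq_top (k := k) (H := H) hA] at hm
      induction hm using Submodule.span_induction with
      | mem n hn =>
        exact Submodule.subset_span ⟨⟨p n, IsColinear.coact_coinvariant hp hn⟩,
          Submodule.subset_span ⟨p, n, hp, hn, rfl⟩, rfl⟩
      | zero => rw [map_zero]; exact Submodule.zero_mem _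
      | add x y _ _ hx hy => rw [map_add]; exact Submodule.add_mem _ hx hy
      | smul a x _ hx => rw [map_smul]; exact Submodule.smul_mem _ a hx
    | zero => intro m; exact Submodule.zero_mem _
    | add f g _ _ hf hg => intro m; exact Submodule.add_mem _ (hf m) (hg m)
    | smul b f _ hf => intro m; exact hf _
  have htop : Submodule.span (coinvariants k H A) S = ⊤ := by
    apply eq_top_of_one_mem_span hA.2
    obtain ⟨n, i, p, hpi⟩ := hM.2
    have h1 := LinearMap.congr_fun hpi 1
    rw [LinearMap.comp_apply, LinearMap.id_apply, ← Finset.univ_sum_single (i 1), map_sum] at h1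
    rw [← h1]
    exact Submodule.sum_mem _ fun j _ =>
      hspan (p ∘ₗ LinearMap.single A (fun _ => M) j : M →ₗ[A] A) (i 1 j)
  have h1 : (1 : coinvariants k H A) ∈ Submodule.span (coinvariants k H A) S := htop ▸ trivial
  obtain ⟨n, r, s, hrs⟩ := Submodule.mem_span_set'.1 h1
  choose p y hp hy hpy using fun j => (s j).2
  refine isHopfSummandOfPower_ring_iff.2 ⟨n, p, fun j => (r j : A) • y j, hp, fun j => ?_, ?_⟩
  · have := (coactLinear k H A M).map_smul (r j) (y j)
    refine this.trans ?_
    change r j • coact k H M (y j) = _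
    rw [hy j]; rfl
  · have := congrArg (Subtype.val : coinvariants k H A → A) hrs
    rw [OneMemClass.coe_one, AddSubmonoidClass.coe_finsetSum] at this
    rw [← this]
    refine Finset.sum_congr rfl fun j _ => ?_
    exact ((p j : M →ₗ[A] A).map_smul (r j : A) (y j)).trans
      (congrArg (fun x => (r j : A) * x) (hpy j))

theorem isHopfSummandOfPower_self_of_galois (hA : IsRightFaithfullyFlatGalois k H A)
    (hM : IsSummandOfPower A M A)
    (hB : IsRightFaithfullyFlatGalois k H (rationalEndOp k H A M)) :
    IsHopfSummandOfPower k H A M A := by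
  set T := coinvariants k H (rationalEndOp k H A M) with hT
  set S : Set T := {t | ∃ (p : HomDual A M) (n : M),
    IsColinear k H (HomDual.toHom k A M p) ∧ coact k H M n = n ⊗ₜ 1 ∧
      ∀ m, coinvariantEnd t m = p m • n} with hS
  set J := Submodule.span (rationalEndOp k H A M)
    ((fun t : T => (t : rationalEndOp k H A M)) '' Submodule.span T S) with hJ
  have hspan : ∀ (m : M) (f : HomDual A M), ∃ b ∈ J, ∀ x,
      (b : (Module.End A M)ᵐᵒᵖ).unop x = f x • m := by
    intro m
    have hm : m ∈ (⊤ : Submodule A M) := trivial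
    rw [← span_coinvariants_eq_top (k := k) (H := H) hA] at hm
    induction hm using Submodule.span_induction with
    | mem n hn =>
      intro f
      have hf : f ∈ (⊤ : Submodule (rationalEndOp k H A M) (HomDual A M)) := trivial
      rw [← HomDual.span_colinear_eq_top hM hB] at hf
      induction hf using Submodule.span_induction with
      | mem p hp =>
        set t : T := colinearEnd (LinearMap.toSpanSingleton A M n ∘ₗ (p : M →ₗ[A] A))
          ((isColinear_toSpanSingleton hn).comp hp)
        refine ⟨t, Submodule.subset_span ⟨t, Submodule.subset_span ⟨p, n, hp, hn, ?_⟩, rfl⟩, ?_⟩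
        · intro x; rfl
        · intro x; rfl
      | zero => exact ⟨0, J.zero_mem, fun x => (zero_smul A n).symm⟩
      | add f g _ _ hf hg =>
        obtain ⟨b, hb, hb'⟩ := hf
        obtain ⟨c, hc, hc'⟩ := hg
        refine ⟨b + c, J.add_mem hb hc, fun x => ?_⟩
        exact (congrArg₂ (· + ·) (hb' x) (hc' x)).trans (add_smul (f x) (g x) n).symm
      | smul c f _ hf =>
        obtain ⟨b, hb, hb'⟩ := hf
        exact ⟨c * b, J.smul_mem c hb, fun x => hb' _⟩
    | zero => exact fun f => ⟨0, J.zero_mem, fun x => (smul_zero (f x)).symm⟩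
    | add m m' _ _ hm hm' =>
      intro f
      obtain ⟨b, hb, hb'⟩ := hm f
      obtain ⟨c, hc, hc'⟩ := hm' f
      refine ⟨b + c, J.add_mem hb hc, fun x => ?_⟩
      exact (congrArg₂ (· + ·) (hb' x) (hc' x)).trans (smul_add (f x) m m').symm
    | smul a m _ hm =>
      intro f
      obtain ⟨b, hb, hb'⟩ := hm (LinearMap.toSpanSingleton A A a ∘ₗ (f : M →ₗ[A] A) : M →ₗ[A] A)
      exact ⟨b, hb, fun x => (hb' x).trans (mul_smul (f x) a m)⟩
  have htop : Submodule.span T S = ⊤ := by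
    apply eq_top_of_one_mem_span hB.2
    obtain ⟨n, F, y, hF⟩ := hM.exists_dual_basis
    choose b hb hb' using fun j => hspan (y j) (F j)
    have : (1 : rationalEndOp k H A M) = ∑ j, b j := by
      apply rationalEndOp_ext
      intro m
      change m = rationalEndOpToHom k H A M (∑ j, b j) m
      simp only [map_sum, LinearMap.sum_apply, rationalEndOpToHom_apply, hb']
      exact (hF m).symm
    rw [this]
    exact Submodule.sum_mem _ fun j _ => hb j
  have h1 : (1 : T) ∈ Submodule.span T S := htop ▸ trivial
  obtain ⟨n, r, s, hrs⟩ := Submodule.mem_span_set'.1 h1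
  choose p y hp hy hpy using fun j => (s j).2
  refine isHopfSummandOfPower_self_iff.2 ⟨n, fun j => (p j : M →ₗ[A] A) ∘ₗ coinvariantEnd (r j), y,
    fun j => IsColinear.comp (hp j) (isColinear_coinvariantEnd (r j)), hy, fun m => ?_⟩
  have h2 : ∀ x : T, coinvariantEnd x m = rationalEndOpToHom k H A M x m := fun _ => rfl
  have h3 := congrArg (fun x : T => rationalEndOpToHom k H A M x m) hrs
  simp only [AddSubmonoidClass.coe_finsetSum, map_sum, LinearMap.sum_apply] at h3
  refine Eq.trans ?_ h3
  exact Finset.sum_congr rfl fun j _ => (hpy j (coinvariantEnd (r j) m)).symm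

end GaloisToProgenerator

end HopfGalois

namespace HopfGalois

open BalancedTensor

/-! ### Retracts of right modules -/

section Retract

variable {k R P P' : Type*} [CommRing k] [Ring R] [AddCommGroup P] [Module k P] [Module Rᵐᵒᵖ P]
  [AddCommGroup P'] [Module k P'] [Module Rᵐᵒᵖ P'] {n : ℕ}

theorem BalancedTensor.sum_mapLeft_mapLeft (X : Type*) [AddCommGroup X] [Module k X] [Module R X]
    {α : Fin n → P →ₗ[k] P'}
    (hα : ∀ j (r : R) (p : P), α j (MulOpposite.op r • p) = MulOpposite.op r • α j p)
    {β : Fin n → P' →ₗ[k] P}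
    (hβ : ∀ j (r : R) (p : P'), β j (MulOpposite.op r • p) = MulOpposite.op r • β j p)
    (h : ∀ p, ∑ j, β j (α j p) = p) (z : BalancedTensor k R P X) :
    ∑ j, mapLeft k X (β j) (hβ j) (mapLeft k X (α j) (hα j) z) = z := by
  induction z using BalancedTensor.induction_on with
  | zero => simp
  | add x y hx hy => simp only [map_add, Finset.sum_add_distrib, hx, hy]
  | tmul p x => simp only [mapLeft_tmul, ← BalancedTensor.sum_tmul, h]

theorem BalancedTensor.subsingleton_of_retract (X : Type*) [AddCommGroup X] [Module k X]
    [Module R X] {α : Fin n → P →ₗ[k] P'}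
    (hα : ∀ j (r : R) (p : P), α j (MulOpposite.op r • p) = MulOpposite.op r • α j p)
    {β : Fin n → P' →ₗ[k] P}
    (hβ : ∀ j (r : R) (p : P'), β j (MulOpposite.op r • p) = MulOpposite.op r • β j p)
    (h : ∀ p, ∑ j, β j (α j p) = p) (hX : Subsingleton (BalancedTensor k R P' X)) :
    Subsingleton (BalancedTensor k R P X) := by
  refine ⟨fun z w => ?_⟩
  rw [← sum_mapLeft_mapLeft X hα hβ h z, ← sum_mapLeft_mapLeft X hα hβ h w]
  exact Finset.sum_congr rfl fun j _ => congrArg _ (Subsingleton.elim _ _)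

theorem BalancedTensor.mapLeft_map [Algebra k R] {X X' : Type*} [AddCommGroup X] [Module k X]
    [Module R X] [IsScalarTower k R X] [AddCommGroup X'] [Module k X'] [Module R X']
    [IsScalarTower k R X'] (f : X →ₗ[R] X') (g : P →ₗ[k] P')
    (hg : ∀ (r : R) (p : P), g (MulOpposite.op r • p) = MulOpposite.op r • g p)
    (z : BalancedTensor k R P X) :
    mapLeft k X' g hg (map k R P f z) = map k R P' f (mapLeft k X g hg z) := by
  induction z using BalancedTensor.induction_on with
  | zero => simp
  | add x y hx hy => simp only [map_add, hx, hy]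
  | tmul p x => simp only [mapLeft_tmul, map_tmul]

theorem BalancedTensor.map_injective_of_retract [Algebra k R] {X X' : Type*} [AddCommGroup X]
    [Module k X] [Module R X] [IsScalarTower k R X] [AddCommGroup X'] [Module k X'] [Module R X']
    [IsScalarTower k R X'] (f : X →ₗ[R] X') {α : Fin n → P →ₗ[k] P'}
    (hα : ∀ j (r : R) (p : P), α j (MulOpposite.op r • p) = MulOpposite.op r • α j p)
    {β : Fin n → P' →ₗ[k] P}
    (hβ : ∀ j (r : R) (p : P'), β j (MulOpposite.op r • p) = MulOpposite.op r • β j p)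
    (h : ∀ p, ∑ j, β j (α j p) = p) (hf : Function.Injective (map k R P' f)) :
    Function.Injective (map k R P f) := by
  intro z w hzw
  rw [← sum_mapLeft_mapLeft X hα hβ h z, ← sum_mapLeft_mapLeft X hα hβ h w]
  refine Finset.sum_congr rfl fun j _ => congrArg _ (hf ?_)
  rw [← mapLeft_map, ← mapLeft_map, hzw]

end Retract

noncomputable section

set_option linter.unusedSectionVars false

/-! ### Coinvariant elements, colinear functionals, and endomorphisms of rank one -/

section RankOne

variable (k H A M : Type*) [CommRing k] [Ring H] [HopfAlgebra k H]
  [BijectiveAntipode k H] [Module.Projective k H]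
  [Ring A] [Algebra k A] [RightComodule k H A]
  [AddCommGroup M] [Module k M] [Module A M] [IsScalarTower k A M]
  [RightComodule k H M]

/-- `M` is a right module over the coinvariants of `END_A(M)ᵒᵖ`. -/
instance coinvariantsOpModule : Module (coinvariants k H (rationalEndOp k H A M))ᵐᵒᵖ M :=
  Module.compHom M
    ({ toFun := fun t => coinvariantEnd t.unop
       map_one' := rfl
       map_mul' := fun _ _ => rfl
       map_zero' := rfl
       map_add' := fun _ _ => rfl } :
      (coinvariants k H (rationalEndOp k H A M))ᵐᵒᵖ →+* Module.End A M)

instance rationalEndOpRightModule :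
    Module (coinvariants k H (rationalEndOp k H A M))ᵐᵒᵖ (rationalEndOp k H A M) :=
  rightModule k (coinvariants k H (rationalEndOp k H A M))

/-- A shortcut that keeps instance search away from the action of the ambient algebra. -/
instance coinvariantsSMul {X : Type*} [AddCommMonoid X]
    [h : Module (coinvariants k H (rationalEndOp k H A M)) X] :
    SMul (coinvariants k H (rationalEndOp k H A M)) X :=
  h.toSMul

variable {k H A M} in
theorem op_smul_eq_coinvariantEnd (t : coinvariants k H (rationalEndOp k H A M)) (m : M) :
    MulOpposite.op t • m = coinvariantEnd t m := rfl

variable {k H A M} in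
theorem coinvariantEnd_algebraMap (c : k) (m : M) :
    coinvariantEnd (algebraMap k (coinvariants k H (rationalEndOp k H A M)) c) m = c • m := rfl

/-- The `A`-linear colinear maps `M → A`, as a subgroup of the dual. -/
def colinearSubgroup : AddSubgroup (HomDual A M) where
  carrier := {p | IsColinear k H (HomDual.toHom k A M p)}
  add_mem' := by
    intro p q hp hq
    have := IsColinear.sum (k := k) (H := H) (Finset.univ : Finset Bool)
      (f := fun b => cond b (HomDual.toHom k A M p) (HomDual.toHom k A M q))
      (by rintro (_ | _) _ <;> assumption)
    simpa using this
  zero_mem' := by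
    change IsColinear k H (HomDual.toHom k A M 0)
    rw [map_zero]
    ext1 m
    simp
  neg_mem' := by
    intro p hp
    change _ = _
    rw [map_neg, LinearMap.rTensor_neg, LinearMap.neg_comp, ← hp, LinearMap.comp_neg]

/-- The left module of `A`-linear colinear maps `M → A` over the coinvariants of `END_A(M)ᵒᵖ`. -/
def ColinearDual : Type _ := colinearSubgroup k H A M

namespace ColinearDual

instance : AddCommGroup (ColinearDual k H A M) :=
  inferInstanceAs (AddCommGroup (colinearSubgroup k H A M))

instance : FunLike (ColinearDual k H A M) M A where
  coe p := (p.1 : HomDual A M)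
  coe_injective _ _ h := Subtype.ext (DFunLike.coe_injective h)

instance : CoeFun (ColinearDual k H A M) fun _ => M → A := ⟨DFunLike.coe⟩

instance : LinearMapClass (ColinearDual k H A M) A M A where
  map_add p := map_add (p.1 : HomDual A M)
  map_smulₛₗ p := map_smul (p.1 : HomDual A M)

variable {k H A M}

@[ext]
theorem ext {p q : ColinearDual k H A M} (h : ∀ m, p m = q m) : p = q := DFunLike.ext _ _ h

/-- The underlying linear map of a colinear map. -/
def toLinearMap (p : ColinearDual k H A M) : M →ₗ[A] A := (p.1 : HomDual A M)

theorem toLinearMap_apply (p : ColinearDual k H A M) (m : M) : p.toLinearMap m = p m := rfl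

theorem isColinear (p : ColinearDual k H A M) :
    IsColinear k H (p.toLinearMap.restrictScalars k) := p.2

variable (k H) in
/-- An `A`-linear colinear map as an element of the colinear dual. -/
def mk (p : M →ₗ[A] A) (hp : IsColinear k H (p.restrictScalars k)) : ColinearDual k H A M :=
  ⟨p, hp⟩

instance : Module (coinvariants k H (rationalEndOp k H A M)) (ColinearDual k H A M) where
  smul t p := mk k H (p.toLinearMap ∘ₗ coinvariantEnd t)
    (p.isColinear.comp (isColinear_coinvariantEnd t))
  one_smul _ := rfl
  mul_smul _ _ _ := rfl
  smul_zero _ := rfl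
  smul_add _ _ _ := rfl
  add_smul _ _ p := ext fun _ => map_add p _ _
  zero_smul p := ext fun _ => map_zero p

theorem smul_apply (t : coinvariants k H (rationalEndOp k H A M)) (p : ColinearDual k H A M)
    (m : M) : (t • p) m = p (coinvariantEnd t m) := rfl

theorem sum_apply {ι : Type*} (s : Finset ι) (p : ι → ColinearDual k H A M) (m : M) :
    (∑ i ∈ s, p i) m = ∑ i ∈ s, p i m := by
  let f : ColinearDual k H A M →+ A :=
    { toFun := fun p => p m
      map_zero' := rfl
      map_add' := fun _ _ => rfl }
  exact map_sum f p s

end ColinearDual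

variable [IsHopfModule k H A M]

variable {k H A M} in
theorem describes_rankOne {X : Type*} [Ring X] [Algebra k X] {e : X →ₗ[k] M →ₗ[k] M}
    (p : ColinearDual k H A M) {E : M →ₗ[k] X}
    (hE : ∀ m x, e (E m) x = p x • m) (m : M) :
    Describes k H e (E m) (E.rTensor H (coact k H M m)) := by
  ext1 x
  have hp := IsColinear.apply p.isColinear x
  rw [LinearMap.coe_restrictScalars, ColinearDual.toLinearMap_apply] at hp
  rw [LinearMap.comp_apply, hE, IsHopfModule.coact_smul, hp, twist, LinearMap.comp_apply]
  induction coact k H M x using TensorProduct.induction_on with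
  | zero => simp
  | add y z hy hz => simp only [map_add, LinearMap.add_apply, hy, hz]
  | tmul x h =>
    induction coact k H M m using TensorProduct.induction_on with
    | zero => simp
    | add y z hy hz =>
      simp only [TensorProduct.lift.tmul, LinearMap.comp_apply, LinearMap.flip_apply] at hy hz ⊢
      simp only [map_add, LinearMap.add_apply, hy, hz]
    | tmul m g => simp [diagAct_tmul, nu_tmul, rightFactorAct_tmul, hE, ColinearDual.toLinearMap_apply]

variable [IsComoduleAlgebra k H A]

/-- The coinvariant elements of a relative Hopf module, as a module over the coinvariants. -/
def coinvariantElements : Submodule (coinvariants k H A) M where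
  carrier := {m | coact k H M m = m ⊗ₜ 1}
  add_mem' := by
    intro m n hm hn
    simp only [Set.mem_ofPred_eq] at hm hn ⊢
    rw [map_add, hm, hn, TensorProduct.add_tmul]
  zero_mem' := by
    simp only [Set.mem_ofPred_eq]
    rw [map_zero, TensorProduct.zero_tmul]
  smul_mem' r m hm := by
    simp only [Set.mem_ofPred_eq] at hm ⊢
    rw [Subalgebra.smul_def, IsHopfModule.coact_smul, coact_coinvariant, hm, diagAct_tmul, one_mul]

variable {k H A M}

/-- The value of a colinear map at a coinvariant element. -/
def colinearEval (p : ColinearDual k H A M) (y : coinvariantElements k H A M) :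
    coinvariants k H A :=
  ⟨p y, IsColinear.coact_coinvariant p.isColinear y.2⟩

/-- The colinear endomorphism `m ↦ p(m) y`. -/
def rankOne (p : ColinearDual k H A M) (y : coinvariantElements k H A M) :
    coinvariants k H (rationalEndOp k H A M) :=
  colinearEnd (LinearMap.toSpanSingleton A M y ∘ₗ p.toLinearMap)
    ((isColinear_toSpanSingleton y.2).comp p.isColinear)

theorem coinvariantEnd_rankOne (p : ColinearDual k H A M) (y : coinvariantElements k H A M)
    (m : M) : coinvariantEnd (rankOne p y) m = p m • (y : M) := rfl

/-- The right multiplication by a coinvariant on the colinear maps `M → A`. -/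
def colinearDualMulRight (r : coinvariants k H A) : ColinearDual k H A M
    →ₗ[coinvariants k H (rationalEndOp k H A M)] ColinearDual k H A M where
  toFun p := ColinearDual.mk k H (LinearMap.toSpanSingleton A A (r : A) ∘ₗ p.toLinearMap)
    ((isColinear_toSpanSingleton (k := k) (H := H) r.2).comp p.isColinear)
  map_add' p q := ColinearDual.ext fun m => add_mul (p m) (q m) (r : A)
  map_smul' _ _ := rfl

theorem colinearDualMulRight_apply (r : coinvariants k H A) (p : ColinearDual k H A M) (m : M) :
    colinearDualMulRight r p m = p m * r := rfl

/-- The element `x ↦ p(x) m` of `END_A(M)ᵒᵖ`, for `p` colinear and `m` arbitrary. -/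
def rationalRankOne (p : ColinearDual k H A M) : M →ₗ[k] rationalEndOp k H A M :=
  LinearMap.codRestrict (Subalgebra.toSubmodule (rationalEndOp k H A M))
    { toFun := fun m => MulOpposite.op
        (LinearMap.toSpanSingleton A M m ∘ₗ p.toLinearMap)
      map_add' := fun m n => MulOpposite.unop_injective
        (LinearMap.ext fun x => smul_add (p x) m n)
      map_smul' := fun c m => MulOpposite.unop_injective
        (LinearMap.ext fun x => smul_comm (p x) c m) }
    fun m => (isRational_unop_iff k H _).2
      ⟨_, describes_rankOne (e := endOpToHom k A M) p (fun _ _ => rfl) m⟩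

theorem rationalRankOne_apply (p : ColinearDual k H A M) (m x : M) :
    ((rationalRankOne p m : rationalEndOp k H A M) : (Module.End A M)ᵐᵒᵖ).unop x =
      p x • m := rfl

theorem coact_rationalRankOne (p : ColinearDual k H A M) (m : M) :
    coact k H (rationalEndOp k H A M) (rationalRankOne p m) =
      (rationalRankOne p).rTensor H (coact k H M m) :=
  (describes_rationalEndOpCoact k H _).unique (rationalEndOpToHom_injective k H A M)
    (describes_rankOne p (fun _ _ => rfl) m)

end RankOne

/-! ### The Morita functor on modules over the coinvariants -/

section Morita

variable (k H A M X : Type*) [CommRing k] [Ring H] [HopfAlgebra k H]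
  [BijectiveAntipode k H] [Module.Projective k H]
  [Ring A] [Algebra k A] [RightComodule k H A] [IsComoduleAlgebra k H A]
  [AddCommGroup M] [Module k M] [Module A M] [IsScalarTower k A M]
  [RightComodule k H M] [IsHopfModule k H A M]
  [AddCommGroup X] [Module k X] [Module (coinvariants k H (rationalEndOp k H A M)) X]
  [IsScalarTower k (coinvariants k H (rationalEndOp k H A M)) X]

/-- For a left module `X` over the coinvariants `T` of `END_A(M)ᵒᵖ`, the module `Hom_T(P, X)`, where
`P` is the module of colinear maps `M → A`. -/
def MoritaHom : Type _ :=
  ColinearDual k H A M →ₗ[coinvariants k H (rationalEndOp k H A M)] X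

namespace MoritaHom

instance : AddCommGroup (MoritaHom k H A M X) :=
  inferInstanceAs (AddCommGroup (_ →ₗ[coinvariants k H (rationalEndOp k H A M)] X))

instance : Module k (MoritaHom k H A M X) :=
  inferInstanceAs (Module k (_ →ₗ[coinvariants k H (rationalEndOp k H A M)] X))

instance : FunLike (MoritaHom k H A M X) (ColinearDual k H A M) X :=
  inferInstanceAs (FunLike (_ →ₗ[coinvariants k H (rationalEndOp k H A M)] X) _ _)

instance : CoeFun (MoritaHom k H A M X) fun _ => ColinearDual k H A M → X := ⟨DFunLike.coe⟩

instance : LinearMapClass (MoritaHom k H A M X) (coinvariants k H (rationalEndOp k H A M))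
    (ColinearDual k H A M) X :=
  inferInstanceAs (LinearMapClass (_ →ₗ[coinvariants k H (rationalEndOp k H A M)] X) _ _ _)

variable {k H A M X}

@[ext]
theorem ext {g g' : MoritaHom k H A M X} (h : ∀ p, g p = g' p) : g = g' := LinearMap.ext h

instance : Module (coinvariants k H A) (MoritaHom k H A M X) where
  smul r g := LinearMap.comp
    (g : ColinearDual k H A M →ₗ[coinvariants k H (rationalEndOp k H A M)] X)
    (colinearDualMulRight r)
  one_smul g := ext fun p => congrArg g (ColinearDual.ext fun m => mul_one (p m))
  mul_smul r s g := ext fun p => congrArg g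
    (ColinearDual.ext fun m => (mul_assoc (p m) (r : A) (s : A)).symm)
  smul_zero _ := rfl
  smul_add _ _ _ := rfl
  add_smul r s g := ext fun p => (congrArg (fun p => g p)
    (ColinearDual.ext (q := colinearDualMulRight r p + colinearDualMulRight s p)
      fun m => mul_add (p m) (r : A) (s : A))).trans (map_add g _ _)
  zero_smul g := ext fun p => (congrArg (fun p => g p)
    (ColinearDual.ext (q := 0) fun m => mul_zero (p m))).trans (map_zero g)

theorem smul_apply (r : coinvariants k H A) (g : MoritaHom k H A M X) (p : ColinearDual k H A M) :
    (r • g) p = g (colinearDualMulRight r p) := rfl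

theorem add_apply (g g' : MoritaHom k H A M X) (p : ColinearDual k H A M) :
    (g + g') p = g p + g' p := rfl

theorem sum_apply {ι : Type*} (s : Finset ι) (g : ι → MoritaHom k H A M X)
    (p : ColinearDual k H A M) : (∑ i ∈ s, g i) p = ∑ i ∈ s, g i p :=
  LinearMap.sum_apply _ _ _

/-- Evaluation at a colinear map. -/
def eval (p : ColinearDual k H A M) : MoritaHom k H A M X →ₗ[k] X where
  toFun g := g p
  map_add' _ _ := rfl
  map_smul' _ _ := rfl

theorem _root_.HopfGalois.colinearDualMulRight_smul (c : k) (r : coinvariants k H A)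
    (p : ColinearDual k H A M) : colinearDualMulRight (c • r) p =
      algebraMap k (coinvariants k H (rationalEndOp k H A M)) c • colinearDualMulRight r p := by
  ext m
  rw [ColinearDual.smul_apply, colinearDualMulRight_apply, colinearDualMulRight_apply,
    coinvariantEnd_algebraMap, ← ColinearDual.toLinearMap_apply _ (c • m),
    LinearMap.map_smul_of_tower, smul_mul_assoc, ← mul_smul_comm]
  rfl

theorem smul_apply' (c : k) (g : MoritaHom k H A M X) (p : ColinearDual k H A M) :
    (c • g) p = c • g p := rfl

instance : IsScalarTower k (coinvariants k H A) (MoritaHom k H A M X) where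
  smul_assoc c r g := by
    refine ext fun p => ?_
    rw [smul_apply, smul_apply', smul_apply, colinearDualMulRight_smul]
    refine (map_smul g _ _).trans ?_
    exact algebraMap_smul (coinvariants k H (rationalEndOp k H A M)) c (g (colinearDualMulRight r p))

/-- The map `x ↦ (p ↦ (p(-) y) x)` from `X` to `Hom_T(P, X)`. -/
def coeval (y : coinvariantElements k H A M) : X →ₗ[k] MoritaHom k H A M X where
  toFun x :=
    ({ toFun := fun p => rankOne p y • x
       map_add' := fun p q => by
        have : rankOne (p + q) y = rankOne p y + rankOne q y := coinvariantEnd_injective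
          (LinearMap.ext fun m => add_smul (p m) _ (y : M))
        rw [this, add_smul]
       map_smul' := fun t p => by
        rw [RingHom.id_apply, ← mul_smul]; rfl } :
      ColinearDual k H A M →ₗ[coinvariants k H (rationalEndOp k H A M)] X)
  map_add' x x' := ext fun _ => smul_add _ x x'
  map_smul' c x := ext fun _ => smul_comm _ c x

theorem coeval_apply (y : coinvariantElements k H A M) (x : X) (p : ColinearDual k H A M) :
    coeval y x p = rankOne p y • x := rfl

theorem coeval_add (y y' : coinvariantElements k H A M) (x : X) :
    coeval (y + y') x = coeval y x + coeval y' x := by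
  ext p
  rw [add_apply, coeval_apply, coeval_apply, coeval_apply, ← add_smul]
  congr 1
  exact coinvariantEnd_injective
    (LinearMap.ext fun m => smul_add (p m) (y : M) (y' : M))

theorem coeval_smul (r : coinvariants k H A) (y : coinvariantElements k H A M) (x : X) :
    coeval (r • y) x = r • coeval y x := by
  ext p
  rw [smul_apply, coeval_apply, coeval_apply]
  congr 1
  exact coinvariantEnd_injective
    (LinearMap.ext fun m => (mul_smul (p m) (r : A) (y : M)).symm)

variable (X) in
/-- The map `y ↦ coeval y x`. -/
def coevalFlip (x : X) :
    coinvariantElements k H A M →ₗ[coinvariants k H A] MoritaHom k H A M X where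
  toFun y := coeval y x
  map_add' y y' := coeval_add y y' x
  map_smul' r y := coeval_smul r y x

/-- The action of a colinear endomorphism on the coinvariant elements. -/
def _root_.HopfGalois.coinvariantEndElement (t : coinvariants k H (rationalEndOp k H A M))
    (y : coinvariantElements k H A M) : coinvariantElements k H A M :=
  ⟨coinvariantEnd t y, IsColinear.coact_coinvariant (isColinear_coinvariantEnd t) y.2⟩

theorem coeval_smul_right (t : coinvariants k H (rationalEndOp k H A M))
    (y : coinvariantElements k H A M) (x : X) :
    coeval y (t • x) = coeval (coinvariantEndElement t y) x := by
  ext p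
  rw [coeval_apply, coeval_apply, ← mul_smul]
  congr 1
  exact coinvariantEnd_injective
    (LinearMap.ext fun m => map_smul (coinvariantEnd t) (p m) (y : M))

variable {X' : Type*} [AddCommGroup X'] [Module k X']
  [Module (coinvariants k H (rationalEndOp k H A M)) X']
  [IsScalarTower k (coinvariants k H (rationalEndOp k H A M)) X']

/-- The map `Hom_T(P, X) → Hom_T(P, X')` given by a `T`-linear map `X → X'`. -/
def map (f : X →ₗ[coinvariants k H (rationalEndOp k H A M)] X') :
    MoritaHom k H A M X →ₗ[coinvariants k H A] MoritaHom k H A M X' where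
  toFun g := LinearMap.comp f
    (g : ColinearDual k H A M →ₗ[coinvariants k H (rationalEndOp k H A M)] X)
  map_add' _ _ := LinearMap.comp_add _ _ _
  map_smul' _ _ := rfl

theorem map_injective (f : X →ₗ[coinvariants k H (rationalEndOp k H A M)] X')
    (hf : Function.Injective f) : Function.Injective (map f) := fun _ _ h =>
  ext fun p => hf (DFunLike.congr_fun h p)

theorem map_coeval (f : X →ₗ[coinvariants k H (rationalEndOp k H A M)] X')
    (y : coinvariantElements k H A M) (x : X) : map f (coeval y x) = coeval y (f x) :=
  ext fun p => map_smul f (rankOne p y) x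

end MoritaHom

end Morita

end

end HopfGalois

namespace HopfGalois

open BalancedTensor

noncomputable section

set_option linter.unusedSectionVars false

/-! ### The Morita equivalence given by an `H`-progenerator -/

section Equivalence

variable {k H A M X : Type*} [CommRing k] [Ring H] [HopfAlgebra k H]
  [BijectiveAntipode k H] [Module.Projective k H]
  [Ring A] [Algebra k A] [RightComodule k H A] [IsComoduleAlgebra k H A]
  [AddCommGroup M] [Module k M] [Module A M] [IsScalarTower k A M]
  [RightComodule k H M] [IsHopfModule k H A M]
  [AddCommGroup X] [Module k X] [Module (coinvariants k H (rationalEndOp k H A M)) X]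
  [IsScalarTower k (coinvariants k H (rationalEndOp k H A M)) X]
  {n n' : ℕ} {q : Fin n → ColinearDual k H A M} {y : Fin n → coinvariantElements k H A M}
  {p : Fin n' → ColinearDual k H A M} {z : Fin n' → coinvariantElements k H A M}

theorem sum_colinearEval_smul (hqy : ∀ m, ∑ j, q j m • (y j : M) = m)
    (w : coinvariantElements k H A M) : ∑ j, colinearEval (q j) w • y j = w := by
  apply Subtype.ext
  rw [AddSubmonoidClass.coe_finsetSum]
  exact hqy w

theorem colinear_induction (hqy : ∀ m, ∑ j, q j m • (y j : M) = m) {motive : M → Prop} (m : M)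
    (add : ∀ m m', motive m → motive m' → motive (m + m'))
    (smul : ∀ (a : A) (w : coinvariantElements k H A M), motive (a • (w : M))) : motive m := by
  rw [← hqy m]
  refine Finset.sum_induction _ motive add ?_ fun j _ => smul _ _
  rw [← zero_smul A ((0 : coinvariantElements k H A M) : M)]
  exact smul _ _

variable (X q y) in
/-- The bilinear map `m, x ↦ ∑ qⱼ(m) ⊗ (p ↦ (p(-) yⱼ) x)`. -/
def moritaBilin : M →ₗ[k] X →ₗ[k] BalancedTensor k (coinvariants k H A) A (MoritaHom k H A M X) :=
  ∑ j, (BalancedTensor.mk k (coinvariants k H A) A (MoritaHom k H A M X)).compl₁₂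
    ((q j).toLinearMap.restrictScalars k) (MoritaHom.coeval (y j))

theorem moritaBilin_smul (hqy : ∀ m, ∑ j, q j m • (y j : M) = m) (a : A)
    (w : coinvariantElements k H A M) (x : X) :
    moritaBilin X q y (a • (w : M)) x = tmul k _ a (MoritaHom.coeval w x) := by
  have h1 : moritaBilin X q y (a • (w : M)) x =
      ∑ j, tmul k _ (q j (a • (w : M))) (MoritaHom.coeval (y j) x) := by
    rw [moritaBilin, LinearMap.sum_apply, LinearMap.sum_apply]; rfl
  have h2 : MoritaHom.coeval w x = ∑ j, colinearEval (q j) w • MoritaHom.coeval (y j) x := by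
    have := congrArg (MoritaHom.coevalFlip X x) (sum_colinearEval_smul hqy w)
    rw [map_sum] at this
    refine this.symm.trans (Finset.sum_congr rfl fun j _ => ?_)
    exact map_smul (MoritaHom.coevalFlip X x) _ _
  rw [h1, h2, BalancedTensor.tmul_sum]
  refine Finset.sum_congr rfl fun j _ => ?_
  rw [← op_smul_tmul, map_smul]; rfl

variable (X) in
/-- The map `M ⊗_T X → A ⊗_R Hom_T(P, X)`. -/
def moritaMap (hqy : ∀ m, ∑ j, q j m • (y j : M) = m) :
    BalancedTensor k (coinvariants k H (rationalEndOp k H A M)) M X →ₗ[k]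
      BalancedTensor k (coinvariants k H A) A (MoritaHom k H A M X) :=
  BalancedTensor.lift (moritaBilin X q y) (by
    intro m t x
    induction m using colinear_induction hqy with
    | add m m' hm hm' => rw [smul_add, map_add, map_add, LinearMap.add_apply,
        LinearMap.add_apply, hm, hm']
    | smul a w =>
      rw [moritaBilin_smul hqy, MoritaHom.coeval_smul_right, ← moritaBilin_smul hqy,
        op_smul_eq_coinvariantEnd, map_smul]
      rfl)

theorem moritaMap_tmul_smul (hqy : ∀ m, ∑ j, q j m • (y j : M) = m) (a : A)
    (w : coinvariantElements k H A M) (x : X) :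
    moritaMap X hqy (tmul k _ (a • (w : M)) x) = tmul k _ a (MoritaHom.coeval w x) :=
  (lift_tmul _ _ _ _).trans (moritaBilin_smul hqy a w x)

variable (X p z) in
/-- The bilinear map `a, g ↦ ∑ a zᵢ ⊗ g(pᵢ)`. -/
def moritaInvBilin : A →ₗ[k] MoritaHom k H A M X →ₗ[k]
    BalancedTensor k (coinvariants k H (rationalEndOp k H A M)) M X :=
  ∑ i, (BalancedTensor.mk k (coinvariants k H (rationalEndOp k H A M)) M X).compl₁₂
    ((LinearMap.toSpanSingleton A M (z i : M)).restrictScalars k) (MoritaHom.eval (p i))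

theorem moritaInvBilin_apply (a : A) (g : MoritaHom k H A M X) :
    moritaInvBilin X p z a g = ∑ i, tmul k _ (a • (z i : M)) (g (p i)) := by
  rw [moritaInvBilin, LinearMap.sum_apply, LinearMap.sum_apply]; rfl

theorem moritaInvBilin_coeval (hpz : ∑ i, p i (z i) = 1) (a : A)
    (w : coinvariantElements k H A M) (x : X) :
    moritaInvBilin X p z a (MoritaHom.coeval w x) = tmul k _ (a • (w : M)) x := by
  rw [moritaInvBilin_apply]
  have h1 : ∀ i, tmul k (coinvariants k H (rationalEndOp k H A M)) (a • (z i : M))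
      (MoritaHom.coeval w x (p i)) = tmul k _ ((a * p i (z i)) • (w : M)) x := by
    intro i
    rw [MoritaHom.coeval_apply, ← op_smul_tmul, op_smul_eq_coinvariantEnd, map_smul,
      coinvariantEnd_rankOne, mul_smul]
  rw [Finset.sum_congr rfl fun i _ => h1 i, ← BalancedTensor.sum_tmul, ← Finset.sum_smul,
    ← Finset.mul_sum, hpz, mul_one]

theorem sum_coeval_eval (hpz : ∑ i, p i (z i) = 1) (g : MoritaHom k H A M X) :
    ∑ i, MoritaHom.coeval (z i) (g (p i)) = g := by
  refine MoritaHom.ext fun p' => ?_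
  have h1 : ∑ i, rankOne p' (z i) • p i = p' := by
    refine ColinearDual.ext fun m => ?_
    rw [ColinearDual.sum_apply]
    have : ∀ i, (rankOne p' (z i) • p i) m = p' m * p i (z i) := fun i => by
      rw [ColinearDual.smul_apply, coinvariantEnd_rankOne, map_smul, smul_eq_mul]
    rw [Finset.sum_congr rfl fun i _ => this i, ← Finset.mul_sum, hpz, mul_one]
  rw [MoritaHom.sum_apply]
  conv_rhs => rw [← h1, map_sum]
  exact Finset.sum_congr rfl fun i _ => (map_smul g _ _).symm

variable (X) in
/-- The map `A ⊗_R Hom_T(P, X) → M ⊗_T X`. -/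
def moritaInv (hpz : ∑ i, p i (z i) = 1) :
    BalancedTensor k (coinvariants k H A) A (MoritaHom k H A M X) →ₗ[k]
      BalancedTensor k (coinvariants k H (rationalEndOp k H A M)) M X :=
  BalancedTensor.lift (moritaInvBilin X p z) (by
    intro a r g
    rw [← sum_coeval_eval hpz g, map_sum, Finset.smul_sum, map_sum]
    refine Finset.sum_congr rfl fun i _ => ?_
    rw [← MoritaHom.coeval_smul, moritaInvBilin_coeval hpz, moritaInvBilin_coeval hpz, op_smul_eq,
      mul_smul]
    rfl)

theorem moritaInv_tmul (hpz : ∑ i, p i (z i) = 1) (a : A) (g : MoritaHom k H A M X) :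
    moritaInv X hpz (tmul k _ a g) = ∑ i, tmul k _ (a • (z i : M)) (g (p i)) :=
  (lift_tmul _ _ _ _).trans (moritaInvBilin_apply a g)

theorem moritaInv_tmul_coeval (hpz : ∑ i, p i (z i) = 1) (a : A)
    (w : coinvariantElements k H A M) (x : X) :
    moritaInv X hpz (tmul k _ a (MoritaHom.coeval w x)) = tmul k _ (a • (w : M)) x :=
  (lift_tmul _ _ _ _).trans (moritaInvBilin_coeval hpz a w x)

theorem moritaInv_moritaMap (hqy : ∀ m, ∑ j, q j m • (y j : M) = m) (hpz : ∑ i, p i (z i) = 1)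
    (v : BalancedTensor k (coinvariants k H (rationalEndOp k H A M)) M X) :
    moritaInv X hpz (moritaMap X hqy v) = v := by
  induction v using BalancedTensor.induction_on with
  | zero => rw [map_zero, map_zero]
  | add v w hv hw => rw [map_add, map_add, hv, hw]
  | tmul m x =>
    induction m using colinear_induction hqy with
    | add m m' hm hm' => rw [BalancedTensor.add_tmul, map_add, map_add, hm, hm']
    | smul a w => rw [moritaMap_tmul_smul, moritaInv_tmul_coeval]

theorem moritaMap_moritaInv (hqy : ∀ m, ∑ j, q j m • (y j : M) = m) (hpz : ∑ i, p i (z i) = 1)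
    (v : BalancedTensor k (coinvariants k H A) A (MoritaHom k H A M X)) :
    moritaMap X hqy (moritaInv X hpz v) = v := by
  induction v using BalancedTensor.induction_on with
  | zero => rw [map_zero, map_zero]
  | add v w hv hw => rw [map_add, map_add, hv, hw]
  | tmul a g =>
    rw [moritaInv_tmul, map_sum]
    conv_rhs => rw [← sum_coeval_eval hpz g, BalancedTensor.tmul_sum]
    exact Finset.sum_congr rfl fun i _ => moritaMap_tmul_smul hqy _ _ _

theorem moritaMap_map {X' : Type*} [AddCommGroup X'] [Module k X']
    [Module (coinvariants k H (rationalEndOp k H A M)) X']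
    [IsScalarTower k (coinvariants k H (rationalEndOp k H A M)) X']
    (hqy : ∀ m, ∑ j, q j m • (y j : M) = m)
    (f : X →ₗ[coinvariants k H (rationalEndOp k H A M)] X')
    (v : BalancedTensor k (coinvariants k H (rationalEndOp k H A M)) M X) :
    moritaMap X' hqy (BalancedTensor.map k _ M f v) =
      BalancedTensor.map k _ A (MoritaHom.map f) (moritaMap X hqy v) := by
  induction v using BalancedTensor.induction_on with
  | zero => simp only [map_zero]
  | add v w hv hw => simp only [map_add, hv, hw]
  | tmul m x =>
    induction m using colinear_induction hqy with
    | add m m' hm hm' => simp only [BalancedTensor.add_tmul, map_add, hm, hm']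
    | smul a w =>
      rw [map_tmul, moritaMap_tmul_smul, moritaMap_tmul_smul, map_tmul, MoritaHom.map_coeval]

/-- The endomorphism algebra as a retract of a power of `M`: evaluation at `m`. -/
def evalEnd (m : M) : rationalEndOp k H A M →ₗ[k] M := (rationalEndOpToHom k H A M).flip m

theorem evalEnd_op_smul (m : M) (t : coinvariants k H (rationalEndOp k H A M))
    (b : rationalEndOp k H A M) :
    evalEnd m (MulOpposite.op t • b) = MulOpposite.op t • evalEnd m b := rfl

theorem rationalRankOne_op_smul (p : ColinearDual k H A M)
    (t : coinvariants k H (rationalEndOp k H A M)) (m : M) :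
    rationalRankOne p (MulOpposite.op t • m) = MulOpposite.op t • rationalRankOne p m :=
  rationalEndOp_ext fun x => (map_smul (coinvariantEnd t) (p x) m).symm

theorem sum_rationalRankOne_evalEnd (hqy : ∀ m, ∑ j, q j m • (y j : M) = m)
    (b : rationalEndOp k H A M) : ∑ j, rationalRankOne (q j) (evalEnd (y j : M) b) = b := by
  apply rationalEndOpToHom_injective k H A M
  ext m
  rw [map_sum, LinearMap.sum_apply]
  conv_rhs => rw [← hqy m, map_sum]
  exact Finset.sum_congr rfl fun j _ =>
    (map_smul (b : (Module.End A M)ᵐᵒᵖ).unop (q j m) (y j : M)).symm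

theorem sum_evalEnd_rationalRankOne (hpz : ∑ i, p i (z i) = 1) (m : M) :
    ∑ i, evalEnd (z i : M) (rationalRankOne (p i) m) = m := by
  have : ∀ i, evalEnd (z i : M) (rationalRankOne (p i) m) = p i (z i) • m := fun _ => rfl
  rw [Finset.sum_congr rfl fun i _ => this i, ← Finset.sum_smul, hpz, one_smul]

end Equivalence

/-! ### Faithful flatness of the endomorphism algebra -/

section Flat

variable {k : Type v} {H A M : Type u} [CommRing k]
  [Ring H] [HopfAlgebra k H] [BijectiveAntipode k H] [Module.Projective k H]
  [Ring A] [Algebra k A] [RightComodule k H A] [IsComoduleAlgebra k H A]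
  [AddCommGroup M] [Module k M] [Module A M] [IsScalarTower k A M]
  [RightComodule k H M] [IsHopfModule k H A M]
  {n n' : ℕ} {q : Fin n → ColinearDual k H A M} {y : Fin n → coinvariantElements k H A M}
  {p : Fin n' → ColinearDual k H A M} {z : Fin n' → coinvariantElements k H A M}

theorem isRightFaithfullyFlat_rationalEndOp
    (hA : IsRightFaithfullyFlat k (coinvariants k H A) A)
    (hqy : ∀ m, ∑ j, q j m • (y j : M) = m) (hpz : ∑ i, p i (z i) = 1) :
    IsRightFaithfullyFlat k (coinvariants k H (rationalEndOp k H A M))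
      (rationalEndOp k H A M) := by
  constructor
  · intro X X' _ _ _ _ _ _ _ _ f hf
    refine map_injective_of_retract f (fun j => evalEnd_op_smul (y j : M))
      (fun j => rationalRankOne_op_smul (q j)) (sum_rationalRankOne_evalEnd hqy) ?_
    have h1 : Function.Injective (moritaMap X hqy) :=
      Function.LeftInverse.injective (moritaInv_moritaMap hqy hpz)
    have h2 := (hA.1 _ _ (MoritaHom.map f) (MoritaHom.map_injective f hf)).comp h1
    intro v w hvw
    apply h2
    change BalancedTensor.map k _ A (MoritaHom.map f) (moritaMap X hqy v) =
      BalancedTensor.map k _ A (MoritaHom.map f) (moritaMap X hqy w)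
    rw [← moritaMap_map, ← moritaMap_map, hvw]
  · intro X _ _ _ _ hX
    have h1 : Subsingleton
        (BalancedTensor k (coinvariants k H (rationalEndOp k H A M)) M X) :=
      subsingleton_of_retract X (fun i => rationalRankOne_op_smul (p i))
        (fun i => evalEnd_op_smul (z i : M)) (sum_evalEnd_rationalRankOne hpz) hX
    have h2 : Subsingleton (MoritaHom k H A M X) := hA.2 _
      (Function.LeftInverse.injective (moritaMap_moritaInv hqy hpz)).subsingleton
    have h3 : ∀ x : X, x = 0 := by
      intro x
      have h4 : ∑ j, rankOne (q j) (y j) = 1 := by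
        apply coinvariantEnd_injective
        ext m
        refine Eq.trans ?_ (hqy m)
        change rationalEndOpToHom k H A M
          ((∑ j, rankOne (q j) (y j) : coinvariants k H (rationalEndOp k H A M)) :
            rationalEndOp k H A M) m = _
        rw [AddSubmonoidClass.coe_finsetSum, map_sum, LinearMap.sum_apply]
        rfl
      rw [← one_smul (coinvariants k H (rationalEndOp k H A M)) x, ← h4, Finset.sum_smul]
      refine Finset.sum_eq_zero fun j _ => ?_
      rw [← MoritaHom.coeval_apply, Subsingleton.elim (MoritaHom.coeval (y j) x) 0]
      rfl
    exact ⟨fun x x' => (h3 x).trans (h3 x').symm⟩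

end Flat

/-! ### The canonical map of the endomorphism algebra -/

theorem can_bijective_of_retract {k H B M : Type*} [CommRing k] [Ring H] [HopfAlgebra k H]
    [Ring B] [Algebra k B] [RightComodule k H B] [IsComoduleAlgebra k H B]
    [AddCommGroup M] [Module k M] [Module (coinvariants k H B)ᵐᵒᵖ M] {n : ℕ}
    {α : Fin n → B →ₗ[k] M}
    (hα : ∀ j (t : coinvariants k H B) (b : B),
      α j (MulOpposite.op t • b) = MulOpposite.op t • α j b)
    {β : Fin n → M →ₗ[k] B}
    (hβ : ∀ j (t : coinvariants k H B) (m : M),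
      β j (MulOpposite.op t • m) = MulOpposite.op t • β j m)
    (h : ∀ b, ∑ j, β j (α j b) = b)
    {γ : BalancedTensor k (coinvariants k H B) M B →ₗ[k] M ⊗[k] H} (hγ : Function.Bijective γ)
    (hγα : ∀ j (b c : B),
      (α j).rTensor H (coact k H B b * (c ⊗ₜ 1)) = γ (tmul k _ (α j b) c))
    (hγβ : ∀ j (m : M) (c : B),
      coact k H B (β j m) * (c ⊗ₜ 1) = (β j).rTensor H (γ (tmul k _ m c))) :
    Function.Bijective (can k H B) := by
  have hid := sum_mapLeft_mapLeft (k := k) B hα hβ h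
  have h1 : ∀ j v, (α j).rTensor H (can k H B v) = γ (mapLeft k B (α j) (hα j) v) := by
    intro j v
    induction v using BalancedTensor.induction_on with
    | zero => simp only [map_zero]
    | add v w hv hw => simp only [map_add, hv, hw]
    | tmul b c => rw [mapLeft_tmul, can_tmul, hγα]
  have h2 : ∀ j v, can k H B (mapLeft k B (β j) (hβ j) v) = (β j).rTensor H (γ v) := by
    intro j v
    induction v using BalancedTensor.induction_on with
    | zero => simp only [map_zero]
    | add v w hv hw => simp only [map_add, hv, hw]
    | tmul m c => rw [mapLeft_tmul, can_tmul, hγβ]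
  constructor
  · intro v w hvw
    rw [← hid v, ← hid w]
    refine Finset.sum_congr rfl fun j _ => congrArg _ (hγ.1 ?_)
    rw [← h1, ← h1, hvw]
  · intro u
    choose v hv using fun j => hγ.2 ((α j).rTensor H u)
    refine ⟨∑ j, mapLeft k B (β j) (hβ j) (v j), ?_⟩
    simp only [map_sum, h2, hv]
    clear hv v
    induction u using TensorProduct.induction_on with
    | zero => simp
    | add u w hu hw => simp only [map_add, Finset.sum_add_distrib, hu, hw]
    | tmul b g => simp only [LinearMap.rTensor_tmul, ← TensorProduct.sum_tmul, h]

section Canonical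

variable {k H A M : Type*} [CommRing k] [Ring H] [HopfAlgebra k H]
  [BijectiveAntipode k H] [Module.Projective k H]
  [Ring A] [Algebra k A] [RightComodule k H A] [IsComoduleAlgebra k H A]
  [AddCommGroup M] [Module k M] [Module A M] [IsScalarTower k A M]
  [RightComodule k H M] [IsHopfModule k H A M]
  {n n' : ℕ} {q : Fin n → ColinearDual k H A M} {y : Fin n → coinvariantElements k H A M}
  {p : Fin n' → ColinearDual k H A M} {z : Fin n' → coinvariantElements k H A M}

variable (k H A M) in
/-- The map `M ⊗_T B → M ⊗ H`, `m ⊗ b ↦ b(m₀) ⊗ m₁`. -/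
def canRight : BalancedTensor k (coinvariants k H (rationalEndOp k H A M)) M
    (rationalEndOp k H A M) →ₗ[k] M ⊗[k] H :=
  BalancedTensor.lift
    ((LinearMap.rTensorHom H ∘ₗ rationalEndOpToHom k H A M).flip ∘ₗ coact k H M) (by
    intro m t b
    have := (isColinear_coinvariantEnd t).apply m
    simp only [LinearMap.comp_apply, LinearMap.flip_apply, LinearMap.coe_rTensorHom,
      op_smul_eq_coinvariantEnd]
    rw [LinearMap.coe_restrictScalars] at this
    rw [this, ← LinearMap.comp_apply, ← LinearMap.rTensor_comp]
    rfl)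

theorem canRight_tmul (m : M) (b : rationalEndOp k H A M) : canRight k H A M (tmul k _ m b) =
    (rationalEndOpToHom k H A M b).rTensor H (coact k H M m) :=
  lift_tmul _ _ _ _

variable (k H A M) in
/-- The map `m ↦ (p ↦ (x ↦ p(x) m))` from `M` to `Hom_T(P, B)`. -/
def moritaRankOne : M →ₗ[coinvariants k H A] MoritaHom k H A M (rationalEndOp k H A M) where
  toFun m :=
    ({ toFun := fun p => rationalRankOne p m
       map_add' := fun p p' => rationalEndOp_ext fun x => add_smul (p x) (p' x) m
       map_smul' := fun _ _ => rfl } : ColinearDual k H A M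
        →ₗ[coinvariants k H (rationalEndOp k H A M)] rationalEndOp k H A M)
  map_add' m m' := MoritaHom.ext fun p => map_add (rationalRankOne p) m m'
  map_smul' r m := MoritaHom.ext fun p => rationalEndOp_ext fun x =>
    (mul_smul (p x) (r : A) m).symm

theorem moritaRankOne_apply (m : M) (p : ColinearDual k H A M) :
    moritaRankOne k H A M m p = rationalRankOne p m := rfl

theorem coeval_eq_moritaRankOne (w : coinvariantElements k H A M) (b : rationalEndOp k H A M) :
    MoritaHom.coeval w b = moritaRankOne k H A M (evalEnd (w : M) b) :=
  MoritaHom.ext fun p => rationalEndOp_ext fun x =>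
    map_smul (b : (Module.End A M)ᵐᵒᵖ).unop (p x) (w : M)

theorem canRight_moritaInv (hpz : ∑ i, p i (z i) = 1)
    (v : BalancedTensor k (coinvariants k H A) A M) :
    canRight k H A M (moritaInv _ hpz (BalancedTensor.map k _ A (moritaRankOne k H A M) v)) =
      canModule k H A M v := by
  induction v using BalancedTensor.induction_on with
  | zero => simp only [map_zero]
  | add v w hv hw => simp only [map_add, hv, hw]
  | tmul a m =>
    rw [map_tmul, moritaInv_tmul, map_sum, canModule_tmul]
    have h1 : ∀ i, canRight k H A M (tmul k _ (a • (z i : M)) (moritaRankOne k H A M m (p i))) =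
        diagAct k H A M (coact k H A a) ((p i (z i) • m) ⊗ₜ 1) := by
      intro i
      have hz : coact k H M (z i : M) = (z i : M) ⊗ₜ 1 := (z i).2
      rw [canRight_tmul, moritaRankOne_apply, IsHopfModule.coact_smul, hz]
      induction coact k H A a using TensorProduct.induction_on with
      | zero => simp
      | add v w hv hw => simp only [map_add, LinearMap.add_apply, hv, hw]
      | tmul a h =>
        rw [diagAct_tmul, diagAct_tmul, LinearMap.rTensor_tmul, rationalEndOpToHom_apply,
          rationalRankOne_apply, map_smul, smul_assoc]
    rw [Finset.sum_congr rfl fun i _ => h1 i, ← map_sum, ← TensorProduct.sum_tmul,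
      ← Finset.sum_smul, hpz, one_smul]

theorem moritaInv_moritaRankOne_surjective (hqy : ∀ m, ∑ j, q j m • (y j : M) = m)
    (hpz : ∑ i, p i (z i) = 1) :
    Function.Surjective (moritaInv (rationalEndOp k H A M) hpz ∘ₗ
      BalancedTensor.map k _ A (moritaRankOne k H A M)) := by
  intro v
  induction v using BalancedTensor.induction_on with
  | zero => exact ⟨0, map_zero _⟩
  | add v w hv hw =>
    obtain ⟨v', rfl⟩ := hv
    obtain ⟨w', rfl⟩ := hw
    exact ⟨v' + w', map_add _ _ _⟩
  | tmul m b =>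
    induction m using colinear_induction hqy with
    | add m m' hm hm' =>
      obtain ⟨v, hv⟩ := hm
      obtain ⟨w, hw⟩ := hm'
      exact ⟨v + w, by rw [map_add, hv, hw, BalancedTensor.add_tmul]⟩
    | smul a w =>
      refine ⟨tmul k _ a (evalEnd (w : M) b), ?_⟩
      rw [LinearMap.comp_apply, map_tmul, ← coeval_eq_moritaRankOne, moritaInv_tmul_coeval]

theorem canRight_bijective (hA : Function.Bijective (can k H A))
    (hqy : ∀ m, ∑ j, q j m • (y j : M) = m) (hpz : ∑ i, p i (z i) = 1) :
    Function.Bijective (canRight k H A M) := by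
  constructor
  · intro v w hvw
    obtain ⟨v, rfl⟩ := moritaInv_moritaRankOne_surjective hqy hpz v
    obtain ⟨w, rfl⟩ := moritaInv_moritaRankOne_surjective hqy hpz w
    rw [LinearMap.comp_apply, LinearMap.comp_apply, canRight_moritaInv, canRight_moritaInv] at hvw
    rw [canModule_injective M hA hvw]
  · intro u
    obtain ⟨v, rfl⟩ := canModule_surjective M hA u
    exact ⟨_, canRight_moritaInv hpz v⟩

theorem coact_evalEnd (w : coinvariantElements k H A M) (b : rationalEndOp k H A M) :
    coact k H M (evalEnd (w : M) b) =
      (evalEnd (w : M)).rTensor H (coact k H (rationalEndOp k H A M) b) := by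
  have h1 := LinearMap.congr_fun (describes_rationalEndOpCoact k H b) (w : M)
  have hw : coact k H M (w : M) = (w : M) ⊗ₜ 1 := w.2
  refine h1.trans ?_
  rw [twist, LinearMap.comp_apply, hw]
  change _ = (evalEnd (w : M)).rTensor H (rationalEndOpCoact k H A M b)
  induction rationalEndOpCoact k H A M b using TensorProduct.induction_on with
  | zero => simp
  | add v w hv hw =>
    rw [map_add, LinearMap.map_add (LinearMap.rTensor H _), ← hv, ← hw]
    simp
  | tmul c h => simp [nu_tmul, evalEnd]

theorem rTensor_evalEnd_coact_mul (w : coinvariantElements k H A M)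
    (b c : rationalEndOp k H A M) :
    (evalEnd (w : M)).rTensor H (coact k H (rationalEndOp k H A M) b * (c ⊗ₜ 1)) =
      canRight k H A M (tmul k _ (evalEnd (w : M) b) c) := by
  rw [canRight_tmul, coact_evalEnd]
  induction coact k H (rationalEndOp k H A M) b using TensorProduct.induction_on with
  | zero => simp
  | add v w hv hw => rw [add_mul, map_add, hv, hw, map_add, map_add]
  | tmul b h =>
    rw [Algebra.TensorProduct.tmul_mul_tmul, mul_one]
    rfl

theorem coact_rationalRankOne_mul (p : ColinearDual k H A M) (m : M) (c : rationalEndOp k H A M) :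
    coact k H (rationalEndOp k H A M) (rationalRankOne p m) * (c ⊗ₜ 1) =
      (rationalRankOne p).rTensor H (canRight k H A M (tmul k _ m c)) := by
  rw [canRight_tmul, coact_rationalRankOne]
  induction coact k H M m using TensorProduct.induction_on with
  | zero => simp
  | add v w hv hw => rw [map_add, add_mul, hv, hw, map_add, map_add]
  | tmul m h =>
    rw [LinearMap.rTensor_tmul, LinearMap.rTensor_tmul, LinearMap.rTensor_tmul,
      Algebra.TensorProduct.tmul_mul_tmul, mul_one]
    congr 1
    exact rationalEndOp_ext fun x => map_smul (c : (Module.End A M)ᵐᵒᵖ).unop (p x) m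

theorem can_rationalEndOp_bijective (hA : Function.Bijective (can k H A))
    (hqy : ∀ m, ∑ j, q j m • (y j : M) = m) (hpz : ∑ i, p i (z i) = 1) :
    Function.Bijective (can k H (rationalEndOp k H A M)) :=
  can_bijective_of_retract (fun j => evalEnd_op_smul (y j : M))
    (fun j => rationalRankOne_op_smul (q j)) (sum_rationalRankOne_evalEnd hqy)
    (canRight_bijective hA hqy hpz) (fun j => rTensor_evalEnd_coact_mul (y j))
    (fun j => coact_rationalRankOne_mul (q j))

end Canonical

end

end HopfGalois

theorem theorem5p10 {k : Type v} {H A M : Type u} [CommRing k]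
    [Ring H] [HopfAlgebra k H] [HopfGalois.BijectiveAntipode k H] [Module.Projective k H]
    [Ring A] [Algebra k A] [HopfGalois.RightComodule k H A] [HopfGalois.IsComoduleAlgebra k H A]
    [AddCommGroup M] [Module k M] [Module A M] [IsScalarTower k A M]
    [HopfGalois.RightComodule k H M] [HopfGalois.IsHopfModule k H A M]
    (hA : HopfGalois.IsRightFaithfullyFlatGalois k H A)
    (hM : HopfGalois.IsProgenerator A M) :
    HopfGalois.IsRightFaithfullyFlatGalois k H (HopfGalois.rationalEndOp k H A M) ↔
      HopfGalois.IsHopfProgenerator k H A M := by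
  constructor
  · intro hB
    exact ⟨HopfGalois.isHopfSummandOfPower_self_of_galois hA hM.1 hB,
      HopfGalois.isHopfSummandOfPower_ring_of_galois hA hM hB⟩
  · rintro ⟨h1, h2⟩
    obtain ⟨n, q, y, hq, hy, hqy⟩ := HopfGalois.isHopfSummandOfPower_self_iff.1 h1
    obtain ⟨n', p, z, hp, hz, hpz⟩ := HopfGalois.isHopfSummandOfPower_ring_iff.1 h2
    let q' := fun j => HopfGalois.ColinearDual.mk k H (q j) (hq j)
    let y' : Fin n → HopfGalois.coinvariantElements k H A M := fun j => ⟨y j, hy j⟩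
    let p' := fun i => HopfGalois.ColinearDual.mk k H (p i) (hp i)
    let z' : Fin n' → HopfGalois.coinvariantElements k H A M := fun i => ⟨z i, hz i⟩
    exact ⟨HopfGalois.can_rationalEndOp_bijective (q := q') (y := y') (p := p') (z := z') hA.1
        hqy hpz,
      HopfGalois.isRightFaithfullyFlat_rationalEndOp (q := q') (y := y') (p := p') (z := z') hA.2
        hqy hpz⟩
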